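/- \textbf{Lemma (Gauss).} Let $(M,g)$ be a smooth Riemannian manifold (Hausdorff, second countable, of dimension $n$, without boundary), write $\langle\cdot,\cdot\rangle=g$, and let $p\in M$. A smooth curve is a geodesic if its velocity is covariantly constant along it with respect to the Levi-Civita connection of $g$. For $v\in T_pM$ such that the geodesic $\gamma$ with $\gamma(0)=p$ and $\gamma'(0)=v$ is defined on $[0,1]$, put $\exp_p(v)=\gamma(1)$. Let $U\subseteq T_pM$ be an open neighbourhood of $0$ on which $\exp_p$ is defined and restricts to a smooth diffeomorphism onto its (open) image. Then for all $v\in U$ and all $w\in T_pM$, \[ \langle D(\exp_p)(v)(v),\; D(\exp_p)(v)(w)\rangle=\langle v,w\rangle , \] where $D(\exp_p)(v):T_pM\to T_{\exp_p(v)}M$ is the derivative of $\exp_p$ at $v$ (with $T_v(T_pM)$ identified with $T_pM$), the left-hand side is taken in $T_{\exp_p(v)}M$ and the right-hand side in $T_pM$. -/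

import Mathlib

open Set Bundle
open scoped Manifold ContDiff

noncomputable section

namespace RiemannianGeometry

variable {n : ℕ} {M : Type*} [TopologicalSpace M] [ChartedSpace (EuclideanSpace ℝ (Fin n)) M]
  [IsManifold (𝓡 n) ∞ M]

/-- The `i`-th vector of the standard basis of `ℝⁿ`. -/
def stdVec (i : Fin n) : EuclideanSpace ℝ (Fin n) := EuclideanSpace.single i 1

/-- A smooth Riemannian metric on the `n`-dimensional smooth manifold `M`. -/
abbrev SmoothMetric (n : ℕ) (M : Type*) [TopologicalSpace M]
    [ChartedSpace (EuclideanSpace ℝ (Fin n)) M] [IsManifold (𝓡 n) ∞ M] :=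
  ContMDiffRiemannianMetric (𝓡 n) ∞ (EuclideanSpace ℝ (Fin n))
    (fun x : M => TangentSpace (𝓡 n) x)

/-- A local coordinate system `φ : M ⊇ φ.source → φ.target ⊆ ℝⁿ`. It is only used for the members
of the maximal smooth atlas of `M`. -/
abbrev Coord (n : ℕ) (M : Type*) [TopologicalSpace M] :=
  OpenPartialHomeomorph M (EuclideanSpace ℝ (Fin n))

/-- The coordinate vector `∂ᵢ`, at the point of `M` with coordinates `x`. -/
def coordVec (φ : Coord n M) (i : Fin n) (x : EuclideanSpace ℝ (Fin n)) :
    TangentSpace (𝓡 n) (φ.symm x) :=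
  mfderiv (𝓡 n) (𝓡 n) φ.symm x (stdVec i)

/-- The matrix `gᵢⱼ = g(∂ᵢ, ∂ⱼ)` of the metric, as a function of the coordinates `x`. -/
def gram (g : SmoothMetric n M) (φ : Coord n M) (x : EuclideanSpace ℝ (Fin n)) :
    Matrix (Fin n) (Fin n) ℝ :=
  Matrix.of fun i j => g.inner (φ.symm x) (coordVec φ i x) (coordVec φ j x)

/-- The partial derivative `∂gⱼₗ/∂xⁱ`. -/
def gramDeriv (g : SmoothMetric n M) (φ : Coord n M) (i j l : Fin n)
    (x : EuclideanSpace ℝ (Fin n)) : ℝ :=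
  fderiv ℝ (fun y => gram g φ y j l) x (stdVec i)

/-- The Christoffel symbols of the Levi-Civita connection,
`Γᵏᵢⱼ = ½ ∑ₗ gᵏˡ (∂ᵢ gⱼₗ + ∂ⱼ gₗᵢ - ∂ₗ gᵢⱼ)`. -/
def christoffel (g : SmoothMetric n M) (φ : Coord n M) (k i j : Fin n)
    (x : EuclideanSpace ℝ (Fin n)) : ℝ :=
  (1 / 2) * ∑ l, (gram g φ x)⁻¹ k l *
    (gramDeriv g φ i j l x + gramDeriv g φ j l i x - gramDeriv g φ l i j x)

/-- The `k`-th component of the tangent vector `X` at `q` in the coordinate basis of `φ`. -/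
def component (φ : Coord n M) (k : Fin n) {q : M} (X : TangentSpace (𝓡 n) q) : ℝ :=
  (EuclideanSpace.proj k : EuclideanSpace ℝ (Fin n) →L[ℝ] ℝ) (mfderiv (𝓡 n) (𝓡 n) φ q X)

/-- The velocity vector `γ'(t)`. -/
def velocity (γ : ℝ → M) (t : ℝ) : TangentSpace (𝓡 n) (γ t) :=
  mfderiv 𝓘(ℝ, ℝ) (𝓡 n) γ t (1 : ℝ)

/-- The `k`-th component, in the coordinates `φ`, of the covariant derivative at time `t` of the
vector field `V` along `γ`, for the pull back along `γ` of the Levi-Civita connection of `g`: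
`(Vᵏ)'(t) + ∑ᵢⱼ Γᵏᵢⱼ(γ(t)) (γⁱ)'(t) Vʲ(t)`. -/
def covDerivAlong (g : SmoothMetric n M) (φ : Coord n M) (γ : ℝ → M)
    (V : (t : ℝ) → TangentSpace (𝓡 n) (γ t)) (k : Fin n) (t : ℝ) : ℝ :=
  deriv (fun s => component φ k (V s)) t +
    ∑ i, ∑ j, christoffel g φ k i j (φ (γ t)) *
      component φ i (velocity (n := n) γ t) * component φ j (V t)

/-- `γ` restricts to a geodesic on the open interval `J`: it is smooth there and its velocity is
covariantly constant, which is expressed in all smooth coordinate systems. -/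
structure IsGeodesicOn (g : SmoothMetric n M) (γ : ℝ → M) (J : Set ℝ) : Prop where
  smooth : ContMDiffOn 𝓘(ℝ, ℝ) (𝓡 n) ∞ γ J
  covariantlyConstant : ∀ φ ∈ IsManifold.maximalAtlas (𝓡 n) ∞ M, ∀ t ∈ J, γ t ∈ φ.source →
    ∀ k, covDerivAlong g φ γ (velocity γ) k t = 0

/-- `γ` is a geodesic, defined on an open interval that contains `[0, 1]`, such that `γ(0) = p`
and `γ'(0) = v`. -/
def IsGeodesicFrom (g : SmoothMetric n M) (p : M) (v : TangentSpace (𝓡 n) p) (γ : ℝ → M) : Prop :=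
  (∃ ε > 0, IsGeodesicOn g γ (Ioo (-ε) (1 + ε))) ∧
    (⟨γ 0, velocity γ 0⟩ : TangentBundle (𝓡 n) M) = ⟨p, v⟩

/-- The set of all `v ∈ T_pM` at which the exponential map is defined. The tangent space `T_pM` is,
as in the library, the vector space `ℝⁿ` (by means of the preferred chart at `p`); it is
written as `ℝⁿ` here to have its topology and smooth structure available. -/
def expDomain (g : SmoothMetric n M) (p : M) : Set (EuclideanSpace ℝ (Fin n)) :=
  {v | ∃ γ : ℝ → M, IsGeodesicFrom g p v γ}

open Classical in
/-- The exponential map `exp_p(v) = γ(1)`, where `γ` is the geodesic such that `γ(0) = p` and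
`γ'(0) = v`; its value outside its domain `expDomain g p` is irrelevant. -/
def expMap (g : SmoothMetric n M) (p : M) (v : EuclideanSpace ℝ (Fin n)) : M :=
  if h : v ∈ expDomain g p then h.choose 1 else p

/-- `f` restricted to `U` is a smooth diffeomorphism from the open set `U` onto its image, an open
subset of `M`: it is smooth and has a smooth inverse `h : f(U) → U`. -/
structure IsDiffeoOnImage (f : EuclideanSpace ℝ (Fin n) → M)
    (U : Set (EuclideanSpace ℝ (Fin n))) : Prop where
  isOpen_source : IsOpen U
  isOpen_image : IsOpen (f '' U)
  smooth : ContMDiffOn (𝓡 n) (𝓡 n) ∞ f U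
  smooth_inverse : ∃ h : M → EuclideanSpace ℝ (Fin n),
    ContMDiffOn (𝓡 n) (𝓡 n) ∞ h (f '' U) ∧ ∀ x ∈ U, h (f x) = x

/-- The derivative `D exp_p(v) : T_pM → T_{exp_p(v)}M`. -/
def dExp (g : SmoothMetric n M) (p : M) (v : EuclideanSpace ℝ (Fin n)) :
    TangentSpace (𝓡 n) p →L[ℝ] TangentSpace (𝓡 n) (expMap g p v) :=
  mfderiv (𝓡 n) (𝓡 n) (expMap g p) v

end RiemannianGeometry

end

open Filter Topology

noncomputable section

set_option linter.unusedSectionVars false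
set_option synthInstance.maxHeartbeats 200000

/-! The proof is the first variation formula, in a form that never differentiates geodesics with
respect to their initial velocity at intermediate times. Let `γ₀` and `γ s` be the geodesics from
`p` with initial velocities `v` and `v + s • w`. In a chart, pair the displacement from `γ₀` to `γ
s` with the velocity of `γ₀`. By the Euler-Lagrange equation (`metricForm_accel`), the time
derivative of this pairing is the differential of the energy at the state of `γ₀`, applied to the
difference of the two states (`hasDerivAt_pairing`). Taylor's formula replaces this by the
difference of the two energies, up to the square of the difference of states.

Speeds are constant, so the energies differ by `s⟨v,w⟩ + O(s²)` at all times; Grönwall's inequality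
makes the states `O(s)`-close. Hence the pairing grows at the rate `s⟨v,w⟩ + O(s²)`. A change of
chart alters it only by `O(s²)`, so finitely many charts along `[0, 1]` give `s⟨v,w⟩ + O(s²)` at
time `1`.

The displacement at time `1` is `s • D exp(w) + o(s)` in a chart, and the velocity of `γ₀` there is
`D exp(v)`, because `exp(cv) = γ₀(c)` for `c` near `1`. Comparing the coefficients of `s` gives the
lemma. -/

/-- First order Taylor formula with a locally uniform quadratic remainder. -/
theorem ContDiffAt.exists_norm_sub_fderiv_le {X Y : Type*} [NormedAddCommGroup X] [NormedSpace ℝ X]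
    [NormedAddCommGroup Y] [NormedSpace ℝ Y] {f : X → Y} {x : X} (hf : ContDiffAt ℝ 2 f x) :
    ∃ C : ℝ, 0 ≤ C ∧ ∃ S ∈ 𝓝 x, ∀ y ∈ S, ∀ z ∈ S,
      ‖f z - f y - fderiv ℝ f y (z - y)‖ ≤ C * ‖z - y‖ ^ 2 := by
  obtain ⟨K, t, ht, hK⟩ := (hf.fderiv_right (m := 1) le_rfl).exists_lipschitzOnWith
  have hd : ∀ᶠ y in 𝓝 x, DifferentiableAt ℝ f y :=
    (hf.eventually (by simp)).mono fun y hy => hy.differentiableAt (by simp)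
  obtain ⟨r, hr, hball⟩ := Metric.mem_nhds_iff.1 (inter_mem ht hd)
  refine ⟨K, K.2, Metric.ball x r, Metric.ball_mem_nhds x hr, fun y hy z hz => ?_⟩
  -- On the ball of radius `‖z - y‖` about `y` the derivative differs from its value at `y` by at
  -- most `K * ‖z - y‖`, so the mean value inequality yields the square. Intersecting with the ball
  -- about `x` keeps the set convex and inside the region of control.
  have key := Convex.norm_image_sub_le_of_norm_fderiv_le' (𝕜 := ℝ) (f := f)
    (s := Metric.ball x r ∩ Metric.closedBall y ‖z - y‖) (C := K * ‖z - y‖)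
    (φ := fderiv ℝ f y) (x := y) (y := z) (fun u hu => (hball hu.1).2) (fun u hu => ?_)
    ((convex_ball x r).inter (convex_closedBall _ _)) ⟨hy, by simp⟩ ⟨hz, by simp [dist_eq_norm]⟩
  · rwa [mul_assoc, ← sq] at key
  · have h1 := hK.dist_le_mul u (hball hu.1).1 y (hball hy).1
    rw [dist_eq_norm, dist_eq_norm] at h1
    refine h1.trans ?_
    have h2 : ‖u - y‖ ≤ ‖z - y‖ := by simpa [dist_eq_norm] using hu.2
    gcongr

theorem hasFDerivAt_bilin_apply {X Y : Type*} [NormedAddCommGroup X] [NormedSpace ℝ X]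
    [NormedAddCommGroup Y] [NormedSpace ℝ Y] {B : X → Y →L[ℝ] Y →L[ℝ] ℝ} {x : X}
    (hB : DifferentiableAt ℝ B x) (u v : Y) :
    HasFDerivAt (fun x => B x u v) (((fderiv ℝ B x).flip u).flip v) x := by
  simpa using (hB.hasFDerivAt.clm_apply (hasFDerivAt_const u x)).clm_apply (hasFDerivAt_const v x)

/-! ### The metric, the Christoffel symbols and the Euler-Lagrange equation in coordinates. -/

namespace RiemannianGeometry

variable {n : ℕ} {M : Type*} [TopologicalSpace M] [ChartedSpace (EuclideanSpace ℝ (Fin n)) M]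
  [IsManifold (𝓡 n) ∞ M]

theorem sum_smul_stdVec (u : EuclideanSpace ℝ (Fin n)) : ∑ i, u i • stdVec i = u := by
  ext k
  simp [stdVec, Pi.single_apply]

theorem stdVec_apply (i k : Fin n) :
    (stdVec i : EuclideanSpace ℝ (Fin n)) k = if k = i then 1 else 0 := by
  simp [stdVec]

/-- The metric in the coordinates `φ`, as a bilinear form depending on the coordinates `x`. -/
def metricForm (g : SmoothMetric n M) (φ : Coord n M) (x : EuclideanSpace ℝ (Fin n)) :
    EuclideanSpace ℝ (Fin n) →L[ℝ] EuclideanSpace ℝ (Fin n) →L[ℝ] ℝ :=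
  ∑ i, ∑ j, gram g φ x i j •
    (EuclideanSpace.proj i : EuclideanSpace ℝ (Fin n) →L[ℝ] ℝ).smulRight
      (EuclideanSpace.proj j : EuclideanSpace ℝ (Fin n) →L[ℝ] ℝ)

theorem bilin_eq_sum (B : EuclideanSpace ℝ (Fin n) →L[ℝ] EuclideanSpace ℝ (Fin n) →L[ℝ] ℝ)
    (D : EuclideanSpace ℝ (Fin n) →L[ℝ] EuclideanSpace ℝ (Fin n))
    (u v : EuclideanSpace ℝ (Fin n)) :
    B (D u) (D v) = ∑ i, ∑ j, B (D (stdVec i)) (D (stdVec j)) * (u i * v j) := by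
  conv_lhs => rw [← sum_smul_stdVec u, ← sum_smul_stdVec v]
  simp only [map_sum, map_smul, sum_apply, _root_.smul_apply, smul_eq_mul,
    Finset.mul_sum]
  rw [Finset.sum_comm]
  refine Finset.sum_congr rfl fun i _ => Finset.sum_congr rfl fun j _ => ?_
  ring

theorem metricForm_apply_eq_sum (g : SmoothMetric n M) (φ : Coord n M)
    (x u v : EuclideanSpace ℝ (Fin n)) :
    metricForm g φ x u v = ∑ i, ∑ j, gram g φ x i j * (u i * v j) := by
  simp [metricForm]

theorem metricForm_apply (g : SmoothMetric n M) (φ : Coord n M)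
    (x u v : EuclideanSpace ℝ (Fin n)) :
    metricForm g φ x u v = g.inner (φ.symm x) (mfderiv (𝓡 n) (𝓡 n) φ.symm x u)
      (mfderiv (𝓡 n) (𝓡 n) φ.symm x v) := by
  rw [metricForm_apply_eq_sum]
  exact (bilin_eq_sum (g.inner (φ.symm x)) (mfderiv (𝓡 n) (𝓡 n) φ.symm x) u v).symm

theorem gram_symm (g : SmoothMetric n M) (φ : Coord n M) (x : EuclideanSpace ℝ (Fin n))
    (i j : Fin n) : gram g φ x i j = gram g φ x j i := g.symm _ _ _

theorem metricForm_symm (g : SmoothMetric n M) (φ : Coord n M)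
    (x u v : EuclideanSpace ℝ (Fin n)) : metricForm g φ x u v = metricForm g φ x v u := by
  rw [metricForm_apply, metricForm_apply, g.symm]

/-- The coordinate fields are the images of constant fields under the tangent map of `φ.symm`, hence
smooth sections along `φ.symm`; the smooth metric is then evaluated on two of them. -/
theorem contDiffOn_gram (g : SmoothMetric n M) {φ : Coord n M}
    (hφ : φ ∈ IsManifold.maximalAtlas (𝓡 n) ∞ M) (i j : Fin n) :
    ContDiffOn ℝ ∞ (fun x => gram g φ x i j) φ.target := by
  have hs : ContMDiffOn (𝓡 n) (𝓡 n) ∞ φ.symm φ.target := contMDiffOn_symm_of_mem_maximalAtlas hφ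
  have hvec : ∀ i : Fin n, ContMDiffOn (𝓡 n) (𝓡 n).tangent ∞
      (fun x => (⟨φ.symm x, coordVec φ i x⟩ : TangentBundle (𝓡 n) M)) φ.target := fun i => by
    have h1 := hs.contMDiffOn_tangentMapWithin (m := ∞) le_rfl φ.open_target.uniqueMDiffOn
    have h2 : ContMDiffOn (𝓡 n) (𝓡 n).tangent ∞
        (fun x : EuclideanSpace ℝ (Fin n) =>
          (⟨x, stdVec i⟩ : TangentBundle (𝓡 n) (EuclideanSpace ℝ (Fin n)))) φ.target :=
      (contMDiff_vectorSpace_iff_contDiff.2 contDiff_const).contMDiffOn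
    refine (h1.comp h2 fun x hx => hx).congr fun x hx => ?_
    simp [tangentMapWithin, coordVec, mfderivWithin_of_isOpen φ.open_target hx]
  rw [← contMDiffOn_iff_contDiffOn]
  have : ContMDiffOn (𝓡 n) ((𝓡 n).prod 𝓘(ℝ)) ∞
      (fun x ↦ TotalSpace.mk' ℝ (E := Bundle.Trivial M ℝ) (φ.symm x) (gram g φ x i j))
      φ.target := by
    apply ContMDiffOn.clm_bundle_apply₂ (F₁ := EuclideanSpace ℝ (Fin n))
      (F₂ := EuclideanSpace ℝ (Fin n))
    · exact g.contMDiff.comp_contMDiffOn hs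
    · exact hvec i
    · exact hvec j
  intro x hx
  have h3 := this x hx
  rw [contMDiffWithinAt_totalSpace] at h3
  exact h3.2

theorem contDiffOn_metricForm (g : SmoothMetric n M) {φ : Coord n M}
    (hφ : φ ∈ IsManifold.maximalAtlas (𝓡 n) ∞ M) :
    ContDiffOn ℝ ∞ (metricForm g φ) φ.target := by
  refine contDiffOn_clm_apply.2 fun u => contDiffOn_clm_apply.2 fun v => ?_
  simp only [metricForm_apply_eq_sum]
  exact ContDiffOn.sum fun i _ => ContDiffOn.sum fun j _ =>
    (contDiffOn_gram g hφ i j).mul contDiffOn_const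

theorem contDiffAt_metricForm (g : SmoothMetric n M) {φ : Coord n M}
    (hφ : φ ∈ IsManifold.maximalAtlas (𝓡 n) ∞ M) {x : EuclideanSpace ℝ (Fin n)}
    (hx : x ∈ φ.target) : ContDiffAt ℝ ∞ (metricForm g φ) x :=
  (contDiffOn_metricForm g hφ).contDiffAt (φ.open_target.mem_nhds hx)

theorem contDiffAt_gram (g : SmoothMetric n M) {φ : Coord n M}
    (hφ : φ ∈ IsManifold.maximalAtlas (𝓡 n) ∞ M) {x : EuclideanSpace ℝ (Fin n)}
    (hx : x ∈ φ.target) (i j : Fin n) : ContDiffAt ℝ ∞ (fun x => gram g φ x i j) x :=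
  (contDiffOn_gram g hφ i j).contDiffAt (φ.open_target.mem_nhds hx)

theorem mfderiv_symm_comp_mfderiv {φ : Coord n M}
    (hφ : φ ∈ IsManifold.maximalAtlas (𝓡 n) ∞ M) {q : M} (hq : q ∈ φ.source)
    (u : TangentSpace (𝓡 n) q) :
    (mfderiv (𝓡 n) (𝓡 n) φ.symm (φ q) (mfderiv (𝓡 n) (𝓡 n) φ q u) : EuclideanSpace ℝ (Fin n)) =
      u := by
  have h1 : MDifferentiableAt (𝓡 n) (𝓡 n) φ q :=
    ((contMDiffOn_of_mem_maximalAtlas hφ).contMDiffAt (φ.open_source.mem_nhds hq)).mdifferentiableAt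
      (by simp)
  have h2 : MDifferentiableAt (𝓡 n) (𝓡 n) φ.symm (φ q) :=
    ((contMDiffOn_symm_of_mem_maximalAtlas hφ).contMDiffAt
      (φ.open_target.mem_nhds (φ.map_source hq))).mdifferentiableAt (by simp)
  have h3 := mfderiv_comp q h2 h1
  have h4 : φ.symm ∘ φ =ᶠ[𝓝 q] id :=
    (φ.open_source.eventually_mem hq).mono fun z hz => φ.left_inv hz
  rw [h4.mfderiv_eq, mfderiv_id] at h3
  exact (congrArg (fun L : EuclideanSpace ℝ (Fin n) →L[ℝ] EuclideanSpace ℝ (Fin n) => L u) h3).symm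

theorem mfderiv_comp_mfderiv_symm {φ : Coord n M}
    (hφ : φ ∈ IsManifold.maximalAtlas (𝓡 n) ∞ M) {x : EuclideanSpace ℝ (Fin n)}
    (hx : x ∈ φ.target) (u : EuclideanSpace ℝ (Fin n)) :
    (mfderiv (𝓡 n) (𝓡 n) φ (φ.symm x) (mfderiv (𝓡 n) (𝓡 n) φ.symm x u) :
      EuclideanSpace ℝ (Fin n)) = u := by
  have h1 : MDifferentiableAt (𝓡 n) (𝓡 n) φ (φ.symm x) :=
    ((contMDiffOn_of_mem_maximalAtlas hφ).contMDiffAt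
      (φ.open_source.mem_nhds (φ.map_target hx))).mdifferentiableAt (by simp)
  have h2 : MDifferentiableAt (𝓡 n) (𝓡 n) φ.symm x :=
    ((contMDiffOn_symm_of_mem_maximalAtlas hφ).contMDiffAt
      (φ.open_target.mem_nhds hx)).mdifferentiableAt (by simp)
  have h3 := mfderiv_comp x h1 h2
  have h4 : φ ∘ φ.symm =ᶠ[𝓝 x] id :=
    (φ.open_target.eventually_mem hx).mono fun z hz => φ.right_inv hz
  rw [h4.mfderiv_eq, mfderiv_id] at h3
  exact (congrArg (fun L : EuclideanSpace ℝ (Fin n) →L[ℝ] EuclideanSpace ℝ (Fin n) => L u) h3).symm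

/-- The metric, computed in coordinates. -/
theorem inner_eq_metricForm (g : SmoothMetric n M) {φ : Coord n M}
    (hφ : φ ∈ IsManifold.maximalAtlas (𝓡 n) ∞ M) {q : M} (hq : q ∈ φ.source)
    (u v : TangentSpace (𝓡 n) q) :
    g.inner q u v = metricForm g φ (φ q) (mfderiv (𝓡 n) (𝓡 n) φ q u)
      (mfderiv (𝓡 n) (𝓡 n) φ q v) := by
  refine Eq.trans ?_ (metricForm_apply g φ (φ q) _ _).symm
  -- The points `φ.symm (φ q)` and `q` are only propositionally equal, so the base point is made a
  -- variable before substituting.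
  have h : ∀ (q' : M) (_ : q' = q) (u' v' : EuclideanSpace ℝ (Fin n)), u' = u → v' = v →
      g.inner q u v = g.inner q' u' v' := by
    rintro q' rfl u' v' rfl rfl
    rfl
  exact h _ (φ.left_inv hq) _ _ (mfderiv_symm_comp_mfderiv hφ hq u)
    (mfderiv_symm_comp_mfderiv hφ hq v)

/-- A kernel vector of the Gram matrix would be null for the metric, against positive definiteness,
since the derivative of `φ.symm` is injective. -/
theorem gram_det_ne_zero (g : SmoothMetric n M) {φ : Coord n M}
    (hφ : φ ∈ IsManifold.maximalAtlas (𝓡 n) ∞ M) {x : EuclideanSpace ℝ (Fin n)}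
    (hx : x ∈ φ.target) : (gram g φ x).det ≠ 0 := by
  intro h
  obtain ⟨u, hu, hu0⟩ := Matrix.exists_mulVec_eq_zero_iff.2 h
  set w : EuclideanSpace ℝ (Fin n) := WithLp.toLp 2 u with hw
  have h1 : metricForm g φ x w w = 0 := by
    rw [metricForm_apply_eq_sum]
    refine Finset.sum_eq_zero fun i _ => ?_
    have h2 := congrFun hu0 i
    simp only [Matrix.mulVec, dotProduct, Pi.zero_apply] at h2
    calc _ = w i * ∑ j, gram g φ x i j * u j := by
            rw [Finset.mul_sum]
            exact Finset.sum_congr rfl fun j _ => by simp only [hw]; ring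
      _ = 0 := by rw [h2, mul_zero]
  rw [metricForm_apply] at h1
  refine (g.pos (φ.symm x) (mfderiv (𝓡 n) (𝓡 n) φ.symm x w) fun h3 => hu ?_).ne' h1
  have h4 := mfderiv_comp_mfderiv_symm hφ hx w
  rw [h3] at h4
  have h5 : w = 0 := h4.symm.trans (map_zero (mfderiv (𝓡 n) (𝓡 n) φ (φ.symm x)))
  ext i
  simpa [hw] using congrArg (fun z : EuclideanSpace ℝ (Fin n) => z i) h5

theorem contDiffAt_gramDeriv (g : SmoothMetric n M) {φ : Coord n M}
    (hφ : φ ∈ IsManifold.maximalAtlas (𝓡 n) ∞ M) {x : EuclideanSpace ℝ (Fin n)}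
    (hx : x ∈ φ.target) (i j l : Fin n) : ContDiffAt ℝ ∞ (gramDeriv g φ i j l) x :=
  ((contDiffAt_gram g hφ hx j l).fderiv_right (m := ∞) le_rfl).clm_apply contDiffAt_const

theorem _root_.ContDiffAt.matrix_det {X ι : Type*} [NormedAddCommGroup X] [NormedSpace ℝ X]
    [Fintype ι] [DecidableEq ι] {A : X → Matrix ι ι ℝ} {x : X} {m : WithTop ℕ∞}
    (h : ∀ i j, ContDiffAt ℝ m (fun x => A x i j) x) : ContDiffAt ℝ m (fun x => (A x).det) x := by
  simp only [Matrix.det_apply']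
  exact ContDiffAt.sum fun σ _ => contDiffAt_const.mul (contDiffAt_prod fun i _ => h _ _)

theorem contDiffAt_gram_inv (g : SmoothMetric n M) {φ : Coord n M}
    (hφ : φ ∈ IsManifold.maximalAtlas (𝓡 n) ∞ M) {x : EuclideanSpace ℝ (Fin n)}
    (hx : x ∈ φ.target) (i j : Fin n) : ContDiffAt ℝ ∞ (fun x => (gram g φ x)⁻¹ i j) x := by
  simp only [Matrix.inv_def, Ring.inverse_eq_inv', Matrix.smul_apply, smul_eq_mul,
    Matrix.adjugate_apply]
  refine ((ContDiffAt.matrix_det (contDiffAt_gram g hφ hx)).inv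
    (gram_det_ne_zero g hφ hx)).mul (ContDiffAt.matrix_det fun a b => ?_)
  simp only [Matrix.updateRow_apply]
  split_ifs
  · exact contDiffAt_const
  · exact contDiffAt_gram g hφ hx a b

theorem contDiffAt_christoffel (g : SmoothMetric n M) {φ : Coord n M}
    (hφ : φ ∈ IsManifold.maximalAtlas (𝓡 n) ∞ M) {x : EuclideanSpace ℝ (Fin n)}
    (hx : x ∈ φ.target) (k i j : Fin n) : ContDiffAt ℝ ∞ (christoffel g φ k i j) x :=
  contDiffAt_const.mul (ContDiffAt.sum fun l _ => (contDiffAt_gram_inv g hφ hx k l).mul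
    (((contDiffAt_gramDeriv g hφ hx i j l).add (contDiffAt_gramDeriv g hφ hx j l i)).sub
      (contDiffAt_gramDeriv g hφ hx l i j)))

/-- The acceleration, in the coordinates `φ`, of a geodesic through the point with coordinates
`z.1` with coordinate velocity `z.2`. -/
def accel (g : SmoothMetric n M) (φ : Coord n M)
    (z : EuclideanSpace ℝ (Fin n) × EuclideanSpace ℝ (Fin n)) : EuclideanSpace ℝ (Fin n) :=
  -∑ k, (∑ i, ∑ j, christoffel g φ k i j z.1 * z.2 i * z.2 j) • stdVec k

theorem contDiffAt_accel (g : SmoothMetric n M) {φ : Coord n M}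
    (hφ : φ ∈ IsManifold.maximalAtlas (𝓡 n) ∞ M) {x : EuclideanSpace ℝ (Fin n)}
    (hx : x ∈ φ.target) (y : EuclideanSpace ℝ (Fin n)) : ContDiffAt ℝ ∞ (accel g φ) (x, y) := by
  have hc : ∀ i : Fin n, ContDiffAt ℝ ∞
      (fun z : EuclideanSpace ℝ (Fin n) × EuclideanSpace ℝ (Fin n) => z.2 i) (x, y) := fun i =>
    (EuclideanSpace.proj i : EuclideanSpace ℝ (Fin n) →L[ℝ] ℝ).contDiff.contDiffAt.comp _
      contDiffAt_snd
  refine ContDiffAt.neg (ContDiffAt.sum fun k _ => ContDiffAt.smul (ContDiffAt.sum fun i _ =>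
    ContDiffAt.sum fun j _ => ((ContDiffAt.mul ?_ (hc i)).mul (hc j))) contDiffAt_const)
  exact ContDiffAt.comp (x, y) (f := Prod.fst) (contDiffAt_christoffel g hφ hx k i j)
    contDiffAt_fst

/-- Quadratic homogeneity in the velocity is what makes a linear change of time preserve geodesics.
-/
theorem accel_smul (g : SmoothMetric n M) (φ : Coord n M) (c : ℝ)
    (x y : EuclideanSpace ℝ (Fin n)) : accel g φ (x, c • y) = c ^ 2 • accel g φ (x, y) := by
  simp only [accel, smul_neg, Finset.smul_sum, smul_smul, Finset.mul_sum]
  refine congrArg _ (Finset.sum_congr rfl fun k _ => ?_)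
  congr 1
  refine Finset.sum_congr rfl fun i _ => Finset.sum_congr rfl fun j _ => ?_
  rw [PiLp.smul_apply, PiLp.smul_apply, smul_eq_mul, smul_eq_mul]
  ring

theorem fderiv_metricForm_apply (g : SmoothMetric n M) {φ : Coord n M}
    (hφ : φ ∈ IsManifold.maximalAtlas (𝓡 n) ∞ M) {x : EuclideanSpace ℝ (Fin n)}
    (hx : x ∈ φ.target) (a u v : EuclideanSpace ℝ (Fin n)) :
    fderiv ℝ (metricForm g φ) x a u v =
      ∑ m, ∑ i, ∑ j, gramDeriv g φ m i j x * (a m * u i * v j) := by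
  have h1 := hasFDerivAt_bilin_apply
    ((contDiffAt_metricForm g hφ hx).differentiableAt (by simp)) u v
  have h2 : HasFDerivAt (fun x => metricForm g φ x u v)
      (∑ i, ∑ j, (u i * v j) • fderiv ℝ (fun x => gram g φ x i j) x) x := by
    simp only [metricForm_apply_eq_sum]
    exact HasFDerivAt.fun_sum fun i _ => HasFDerivAt.fun_sum fun j _ =>
      (((contDiffAt_gram g hφ hx i j).differentiableAt (by simp)).hasFDerivAt).mul_const _
  have h3 := congrArg (fun L => L a) (h1.unique h2)
  have h4 : ∀ i j, fderiv ℝ (fun x => gram g φ x i j) x a = ∑ m, gramDeriv g φ m i j x * a m := by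
    intro i j
    conv_lhs => rw [← sum_smul_stdVec a]
    simp [gramDeriv, mul_comm]
  simp only [ContinuousLinearMap.flip_apply, sum_apply, _root_.smul_apply, h4, smul_eq_mul] at h3
  rw [h3]
  simp only [Finset.mul_sum]
  refine (Finset.sum_congr rfl fun i _ => Finset.sum_comm).trans ?_
  rw [Finset.sum_comm]
  exact Finset.sum_congr rfl fun m _ => Finset.sum_congr rfl fun i _ =>
    Finset.sum_congr rfl fun j _ => by ring

/-- The geodesic equation in lowered form (the Euler-Lagrange equation of the energy). -/
theorem metricForm_accel (g : SmoothMetric n M) {φ : Coord n M}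
    (hφ : φ ∈ IsManifold.maximalAtlas (𝓡 n) ∞ M) {x : EuclideanSpace ℝ (Fin n)}
    (hx : x ∈ φ.target) (y u : EuclideanSpace ℝ (Fin n)) :
    metricForm g φ x u (accel g φ (x, y)) + fderiv ℝ (metricForm g φ) x y u y =
      (1 / 2) * fderiv ℝ (metricForm g φ) x u y y := by
  -- Lowering the upper index of the Christoffel symbol cancels the inverse Gram matrix in its
  -- definition.
  have h1 : ∀ l i j, ∑ k, gram g φ x l k * christoffel g φ k i j x =
      (1 / 2) * (gramDeriv g φ i j l x + gramDeriv g φ j l i x - gramDeriv g φ l i j x) := by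
    intro l i j
    have h2 : gram g φ x * (gram g φ x)⁻¹ = 1 :=
      Matrix.mul_nonsing_inv _ (isUnit_iff_ne_zero.2 (gram_det_ne_zero g hφ hx))
    have h3 := congrArg (fun A => Matrix.mulVec A (fun l =>
      (1 / 2) * (gramDeriv g φ i j l x + gramDeriv g φ j l i x - gramDeriv g φ l i j x)) l) h2
    simp only [← Matrix.mulVec_mulVec, Matrix.one_mulVec] at h3
    rw [← h3]
    simp only [Matrix.mulVec, dotProduct]
    refine Finset.sum_congr rfl fun k _ => ?_
    rw [christoffel, Finset.mul_sum]
    congr 1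
    exact Finset.sum_congr rfl fun m _ => by ring
  have hs : ∀ m i j, gramDeriv g φ m i j x = gramDeriv g φ m j i x := fun m i j => by
    simp only [gramDeriv, gram_symm g φ _ i j]
  have h4 : metricForm g φ x u (accel g φ (x, y)) = -∑ l, ∑ i, ∑ j,
      (1 / 2) * (gramDeriv g φ i j l x + gramDeriv g φ j l i x - gramDeriv g φ l i j x) *
        (u l * y i * y j) := by
    have h5 : ∀ k, accel g φ (x, y) k = -∑ i, ∑ j, christoffel g φ k i j x * y i * y j := by
      intro k
      simp [accel, stdVec_apply]
    simp only [metricForm_apply_eq_sum, ← h1, h5]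
    rw [← Finset.sum_neg_distrib]
    refine Finset.sum_congr rfl fun l _ => ?_
    simp only [mul_neg, Finset.sum_neg_distrib, neg_inj, Finset.mul_sum, Finset.sum_mul]
    rw [Finset.sum_comm]
    refine Finset.sum_congr rfl fun i _ => ?_
    rw [Finset.sum_comm]
    exact Finset.sum_congr rfl fun j _ => Finset.sum_congr rfl fun k _ => by ring
  rw [h4, fderiv_metricForm_apply g hφ hx, fderiv_metricForm_apply g hφ hx]
  -- The first two Christoffel terms agree once contracted with the symmetric tensor `y i * y j`;
  -- together they cancel the derivative term on the left, and the third term is the right-hand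
  -- side.
  have h6 : ∑ l, ∑ i, ∑ j, gramDeriv g φ i j l x * (u l * y i * y j) =
      ∑ m, ∑ i, ∑ j, gramDeriv g φ m i j x * (y m * u i * y j) := by
    rw [Finset.sum_comm]
    refine Finset.sum_congr rfl fun m _ => Finset.sum_congr rfl fun i _ =>
      Finset.sum_congr rfl fun j _ => ?_
    rw [hs m j i]
    ring
  have h7 : ∑ l, ∑ i, ∑ j, gramDeriv g φ j l i x * (u l * y i * y j) =
      ∑ m, ∑ i, ∑ j, gramDeriv g φ m i j x * (y m * u i * y j) := by
    rw [← h6]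
    refine Finset.sum_congr rfl fun l _ => ?_
    rw [Finset.sum_comm]
    refine Finset.sum_congr rfl fun i _ => Finset.sum_congr rfl fun j _ => ?_
    rw [hs i l j]
    ring
  have h8 : ∑ l, ∑ i, ∑ j,
      (1 / 2) * (gramDeriv g φ i j l x + gramDeriv g φ j l i x - gramDeriv g φ l i j x) *
        (u l * y i * y j) =
      (1 / 2) * (∑ l, ∑ i, ∑ j, gramDeriv g φ i j l x * (u l * y i * y j) +
        ∑ l, ∑ i, ∑ j, gramDeriv g φ j l i x * (u l * y i * y j) -
        ∑ l, ∑ i, ∑ j, gramDeriv g φ l i j x * (u l * y i * y j)) := by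
    simp only [← Finset.sum_add_distrib, ← Finset.sum_sub_distrib, Finset.mul_sum]
    exact Finset.sum_congr rfl fun l _ => Finset.sum_congr rfl fun i _ =>
      Finset.sum_congr rfl fun j _ => by ring
  rw [h8, h6, h7]
  ring
-- Geodesics as solutions of a second order ODE in every chart.
/-- Position and velocity of the curve `γ` in the coordinates `φ`. -/
def chartState (φ : Coord n M) (γ : ℝ → M) (t : ℝ) :
    EuclideanSpace ℝ (Fin n) × EuclideanSpace ℝ (Fin n) :=
  (φ (γ t), deriv (φ ∘ γ) t)

/-- The geodesic equation in all smooth coordinate systems, as a second order ODE. -/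
structure SolvesGeodesicODE (g : SmoothMetric n M) (γ : ℝ → M) (J : Set ℝ) : Prop where
  smooth : ContMDiffOn 𝓘(ℝ, ℝ) (𝓡 n) ∞ γ J
  hasDerivAt : ∀ φ ∈ IsManifold.maximalAtlas (𝓡 n) ∞ M, ∀ t ∈ J, γ t ∈ φ.source →
    HasDerivAt (deriv (φ ∘ γ)) (accel g φ (chartState φ γ t)) t

theorem contDiffAt_chart_comp {γ : ℝ → M} {J : Set ℝ} (hJ : IsOpen J)
    (hγ : ContMDiffOn 𝓘(ℝ, ℝ) (𝓡 n) ∞ γ J) {φ : Coord n M}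
    (hφ : φ ∈ IsManifold.maximalAtlas (𝓡 n) ∞ M) {t : ℝ} (ht : t ∈ J) (hs : γ t ∈ φ.source) :
    ContDiffAt ℝ ∞ (φ ∘ γ) t := by
  rw [← contMDiffAt_iff_contDiffAt]
  exact ((contMDiffOn_of_mem_maximalAtlas hφ).contMDiffAt (φ.open_source.mem_nhds hs)).comp t
    (hγ.contMDiffAt (hJ.mem_nhds ht))

theorem eventually_mem_source {γ : ℝ → M} {J : Set ℝ} (hJ : IsOpen J)
    (hγ : ContMDiffOn 𝓘(ℝ, ℝ) (𝓡 n) ∞ γ J) {φ : Coord n M} {t : ℝ} (ht : t ∈ J)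
    (hs : γ t ∈ φ.source) : ∀ᶠ s in 𝓝 t, s ∈ J ∧ γ s ∈ φ.source :=
  (hJ.eventually_mem ht).and
    ((hγ.contMDiffAt (hJ.mem_nhds ht)).continuousAt.eventually_mem (φ.open_source.mem_nhds hs))

theorem mfderiv_chart_velocity {γ : ℝ → M} {J : Set ℝ} (hJ : IsOpen J)
    (hγ : ContMDiffOn 𝓘(ℝ, ℝ) (𝓡 n) ∞ γ J) {φ : Coord n M}
    (hφ : φ ∈ IsManifold.maximalAtlas (𝓡 n) ∞ M) {t : ℝ} (ht : t ∈ J) (hs : γ t ∈ φ.source) :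
    (mfderiv (𝓡 n) (𝓡 n) φ (γ t) (velocity γ t) : EuclideanSpace ℝ (Fin n)) =
      deriv (φ ∘ γ) t := by
  have h1 : MDifferentiableAt 𝓘(ℝ, ℝ) (𝓡 n) γ t :=
    (hγ.contMDiffAt (hJ.mem_nhds ht)).mdifferentiableAt (by simp)
  have h2 : MDifferentiableAt (𝓡 n) (𝓡 n) φ (γ t) :=
    ((contMDiffOn_of_mem_maximalAtlas hφ).contMDiffAt (φ.open_source.mem_nhds hs)).mdifferentiableAt
      (by simp)
  have h3 := mfderiv_comp t h2 h1
  rw [mfderiv_eq_fderiv] at h3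
  exact (congrArg (fun L : ℝ →L[ℝ] EuclideanSpace ℝ (Fin n) => L 1) h3).symm

theorem IsGeodesicOn.solvesGeodesicODE {g : SmoothMetric n M} {γ : ℝ → M} {J : Set ℝ}
    (hJ : IsOpen J) (h : IsGeodesicOn g γ J) : SolvesGeodesicODE g γ J := by
  refine ⟨h.smooth, fun φ hφ t ht hs => ?_⟩
  have hd : DifferentiableAt ℝ (deriv (φ ∘ γ)) t := by
    have h1 := (contDiffAt_chart_comp hJ h.smooth hφ ht hs).fderiv_right (m := ∞) le_rfl
    exact (h1.clm_apply contDiffAt_const).differentiableAt (by simp)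
  have hcomp : ∀ k, (fun s => component φ k (velocity (n := n) γ s)) =ᶠ[𝓝 t]
      fun s => deriv (φ ∘ γ) s k := fun k =>
    (eventually_mem_source hJ h.smooth ht hs).mono fun s hs' =>
      congrArg (fun z : EuclideanSpace ℝ (Fin n) => z k)
        (mfderiv_chart_velocity hJ h.smooth hφ hs'.1 hs'.2)
  have hd' : ∀ k, HasDerivAt (fun s => deriv (φ ∘ γ) s k) (deriv (deriv (φ ∘ γ)) t k) t :=
    fun k => (EuclideanSpace.proj k : EuclideanSpace ℝ (Fin n) →L[ℝ] ℝ).hasFDerivAt.comp_hasDerivAt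
      t hd.hasDerivAt
  refine hd.hasDerivAt.congr_deriv ?_
  ext k
  have h2 := h.covariantlyConstant φ hφ t ht hs k
  have h3 : ∀ k, component φ k (velocity (n := n) γ t) = deriv (φ ∘ γ) t k :=
    fun k => (hcomp k).self_of_nhds
  simp only [covDerivAlong, (hcomp k).deriv_eq, (hd' k).deriv, h3] at h2
  rw [eq_neg_of_add_eq_zero_left h2]
  simp [accel, stdVec_apply, chartState]

section

variable {g : SmoothMetric n M} {γ : ℝ → M} {J : Set ℝ} {φ : Coord n M} {t : ℝ}

theorem SolvesGeodesicODE.hasDerivAt_chart (h : SolvesGeodesicODE g γ J) (hJ : IsOpen J)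
    (hφ : φ ∈ IsManifold.maximalAtlas (𝓡 n) ∞ M) (ht : t ∈ J) (hs : γ t ∈ φ.source) :
    HasDerivAt (fun t => φ (γ t)) (deriv (φ ∘ γ) t) t :=
  ((contDiffAt_chart_comp hJ h.smooth hφ ht hs).differentiableAt (by simp)).hasDerivAt

theorem SolvesGeodesicODE.hasDerivAt_chartState (h : SolvesGeodesicODE g γ J) (hJ : IsOpen J)
    (hφ : φ ∈ IsManifold.maximalAtlas (𝓡 n) ∞ M) (ht : t ∈ J) (hs : γ t ∈ φ.source) :
    HasDerivAt (chartState φ γ) ((chartState φ γ t).2, accel g φ (chartState φ γ t)) t :=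
  (h.hasDerivAt_chart hJ hφ ht hs).prodMk (h.hasDerivAt φ hφ t ht hs)

end

/-! ### Energy, its conservation, and the pairing with a displacement. -/

/-- Half the square of the speed, in the coordinates `φ`. -/
def energy (g : SmoothMetric n M) (φ : Coord n M)
    (z : EuclideanSpace ℝ (Fin n) × EuclideanSpace ℝ (Fin n)) : ℝ :=
  (1 / 2) * metricForm g φ z.1 z.2 z.2

theorem contDiffAt_energy (g : SmoothMetric n M) {φ : Coord n M}
    (hφ : φ ∈ IsManifold.maximalAtlas (𝓡 n) ∞ M) {x : EuclideanSpace ℝ (Fin n)}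
    (hx : x ∈ φ.target) (y : EuclideanSpace ℝ (Fin n)) : ContDiffAt ℝ ∞ (energy g φ) (x, y) :=
  contDiffAt_const.mul (((ContDiffAt.comp (x, y) (f := Prod.fst) (contDiffAt_metricForm g hφ hx)
    contDiffAt_fst).clm_apply contDiffAt_snd).clm_apply contDiffAt_snd)

theorem fderiv_energy_apply (g : SmoothMetric n M) {φ : Coord n M}
    (hφ : φ ∈ IsManifold.maximalAtlas (𝓡 n) ∞ M) {x : EuclideanSpace ℝ (Fin n)}
    (hx : x ∈ φ.target) (y h k : EuclideanSpace ℝ (Fin n)) :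
    fderiv ℝ (energy g φ) (x, y) (h, k) =
      (1 / 2) * fderiv ℝ (metricForm g φ) x h y y + metricForm g φ x k y := by
  have h1 : HasFDerivAt (fun z : EuclideanSpace ℝ (Fin n) × EuclideanSpace ℝ (Fin n) =>
      metricForm g φ z.1) ((fderiv ℝ (metricForm g φ) x).comp (ContinuousLinearMap.fst ℝ _ _))
      (x, y) :=
    HasFDerivAt.comp (x, y) (f := Prod.fst)
      ((contDiffAt_metricForm g hφ hx).differentiableAt (by simp)).hasFDerivAt hasFDerivAt_fst
  have h2 := ((h1.clm_apply hasFDerivAt_snd).clm_apply hasFDerivAt_snd).const_mul (1 / 2)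
  have h3 : fderiv ℝ (energy g φ) (x, y) = _ := h2.fderiv
  rw [h3]
  simp
  rw [metricForm_symm g φ x y k]
  ring

section

variable {g : SmoothMetric n M} {γ : ℝ → M} {J : Set ℝ} {φ : Coord n M} {t : ℝ}

/-- This is the Euler-Lagrange equation tested against the velocity itself. -/
theorem SolvesGeodesicODE.hasDerivAt_energy (h : SolvesGeodesicODE g γ J) (hJ : IsOpen J)
    (hφ : φ ∈ IsManifold.maximalAtlas (𝓡 n) ∞ M) (ht : t ∈ J) (hs : γ t ∈ φ.source) :
    HasDerivAt (fun t => energy g φ (chartState φ γ t)) 0 t := by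
  have hx : (chartState φ γ t).1 ∈ φ.target := φ.map_source hs
  have h1 := ((contDiffAt_energy g hφ hx (chartState φ γ t).2).differentiableAt
    (by simp)).hasFDerivAt.comp_hasDerivAt t (h.hasDerivAt_chartState hJ hφ ht hs)
  have h2 := metricForm_accel g hφ hx (chartState φ γ t).2 (chartState φ γ t).2
  rw [fderiv_energy_apply g hφ hx, metricForm_symm] at h1
  refine h1.congr_deriv ?_
  change metricForm g φ _ _ (accel g φ (chartState φ γ t)) + _ = _ at h2
  linarith

theorem energy_chartState (hJ : IsOpen J) (hγ : ContMDiffOn 𝓘(ℝ, ℝ) (𝓡 n) ∞ γ J)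
    (hφ : φ ∈ IsManifold.maximalAtlas (𝓡 n) ∞ M) (ht : t ∈ J) (hs : γ t ∈ φ.source) :
    energy g φ (chartState φ γ t) = (1 / 2) * g.inner (γ t) (velocity γ t) (velocity γ t) := by
  rw [inner_eq_metricForm g hφ hs]
  have := mfderiv_chart_velocity hJ hγ hφ ht hs
  rw [energy, chartState, ← this]

/-- Geodesics have constant speed. -/
theorem SolvesGeodesicODE.inner_velocity_eq (h : SolvesGeodesicODE g γ J) (hJ : IsOpen J)
    (hJ' : IsPreconnected J) {a b : ℝ} (ha : a ∈ J) (hb : b ∈ J) :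
    g.inner (γ a) (velocity γ a) (velocity γ a) = g.inner (γ b) (velocity γ b) (velocity γ b) := by
  have h1 : ∀ t ∈ J, HasDerivAt
      (fun t => (1 / 2) * g.inner (γ t) (velocity γ t) (velocity γ t)) 0 t := by
    intro t ht
    have hφ := IsManifold.chart_mem_maximalAtlas (I := 𝓡 n) (n := ∞) (γ t)
    have hs := mem_chart_source (EuclideanSpace ℝ (Fin n)) (γ t)
    refine (h.hasDerivAt_energy hJ hφ ht hs).congr_of_eventuallyEq ?_
    exact (eventually_mem_source hJ h.smooth ht hs).mono fun s hs' =>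
      (energy_chartState hJ h.smooth hφ hs'.1 hs'.2).symm
  have h2 := hJ.is_const_of_deriv_eq_zero hJ'
    (fun t ht => (h1 t ht).differentiableAt.differentiableWithinAt)
    (fun t ht => (h1 t ht).deriv) ha hb
  linarith

/-- The derivative of the pairing of the velocity of a geodesic with the displacement to a second
curve is the linearized energy. -/
theorem SolvesGeodesicODE.hasDerivAt_pairing (h : SolvesGeodesicODE g γ J) (hJ : IsOpen J)
    (hφ : φ ∈ IsManifold.maximalAtlas (𝓡 n) ∞ M) (ht : t ∈ J) (hs : γ t ∈ φ.source)
    {x : ℝ → EuclideanSpace ℝ (Fin n)} {y : EuclideanSpace ℝ (Fin n)} (hx : HasDerivAt x y t) :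
    HasDerivAt (fun t => metricForm g φ (φ (γ t)) (x t - φ (γ t)) (deriv (φ ∘ γ) t))
      (fderiv ℝ (energy g φ) (chartState φ γ t) ((x t, y) - chartState φ γ t)) t := by
  have hxt : φ (γ t) ∈ φ.target := φ.map_source hs
  have h0 := h.hasDerivAt_chart hJ hφ ht hs
  have h1 := ((contDiffAt_metricForm g hφ hxt).differentiableAt
    (by simp)).hasFDerivAt.comp_hasDerivAt t h0
  have h2 := (h1.clm_apply (hx.sub h0)).clm_apply (h.hasDerivAt φ hφ t ht hs)
  -- Testing against the displacement trades the acceleration of `γ₀`, and the derivative of the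
  -- metric along `γ₀`, for the derivative of the metric along the displacement, as in the
  -- differential of the energy.
  have h3 := metricForm_accel g hφ hxt (deriv (φ ∘ γ) t) (x t - φ (γ t))
  refine h2.congr_deriv (Eq.trans ?_ (fderiv_energy_apply g hφ hxt (deriv (φ ∘ γ) t)
    (x t - φ (γ t)) (y - deriv (φ ∘ γ) t)).symm)
  rw [← h3]
  simp [chartState]
  ring

/-- Reparametrization of a geodesic by a homothety of time. -/
theorem SolvesGeodesicODE.comp_mul (h : SolvesGeodesicODE g γ J) (c : ℝ) :
    SolvesGeodesicODE g (fun t => γ (c * t)) ((fun t => c * t) ⁻¹' J) := by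
  refine ⟨h.smooth.comp (contMDiff_iff_contDiff.2 (contDiff_const.mul contDiff_id)).contMDiffOn
    fun t ht => ht, fun φ hφ t ht hs => ?_⟩
  have hd : ∀ s, deriv (φ ∘ fun t => γ (c * t)) s = c • deriv (φ ∘ γ) (c * s) := fun s =>
    deriv_comp_mul_left c (φ ∘ γ) s
  have h1 : HasDerivAt (fun t => c * t) c t := by simpa using (hasDerivAt_id t).const_mul c
  have h2 := (HasDerivAt.scomp (h := fun t => c * t) t
    (h.hasDerivAt φ hφ (c * t) ht hs) h1).const_smul c
  rw [chartState, hd t, accel_smul, show deriv (φ ∘ fun t => γ (c * t)) = _ from funext hd]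
  exact h2.congr_deriv (by rw [smul_smul, sq]; rfl)

end
-- Grönwall stability and propagation of the first variation within one chart.
section

variable {g : SmoothMetric n M} {γ₀ : ℝ → M} {J₀ : Set ℝ} {φ : Coord n M}

/-- A geodesic that starts close to a given one stays close to it for a short time, with the
exponential bound of Grönwall's inequality. -/
theorem SolvesGeodesicODE.exists_gronwall [T2Space M] (h₀ : SolvesGeodesicODE g γ₀ J₀)
    (hJ₀ : IsOpen J₀) (hφ : φ ∈ IsManifold.maximalAtlas (𝓡 n) ∞ M) {τ : ℝ} (hτ : τ ∈ J₀)
    (hsτ : γ₀ τ ∈ φ.source) {S : Set (EuclideanSpace ℝ (Fin n) × EuclideanSpace ℝ (Fin n))}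
    (hS : S ∈ 𝓝 (chartState φ γ₀ τ)) :
    ∃ δ > 0, ∃ R > 0, ∃ K : ℝ, 0 ≤ K ∧ ∀ a b : ℝ, τ - δ < a → b < τ + δ →
      ∀ (γ : ℝ → M) (J : Set ℝ), IsOpen J → SolvesGeodesicODE g γ J → Icc a b ⊆ J →
      ∀ η : ℝ, η * Real.exp (K * (2 * δ)) < R → γ a ∈ φ.source →
      ‖chartState φ γ a - chartState φ γ₀ a‖ ≤ η →
      ∀ t ∈ Icc a b, t ∈ J₀ ∧ γ₀ t ∈ φ.source ∧ γ t ∈ φ.source ∧ chartState φ γ₀ t ∈ S ∧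
        chartState φ γ t ∈ S ∧
        ‖chartState φ γ t - chartState φ γ₀ t‖ ≤ η * Real.exp (K * (2 * δ)) := by
  set w := chartState φ γ₀ τ with hw
  have hwt : w.1 ∈ φ.target := φ.map_source hsτ
  set V : EuclideanSpace ℝ (Fin n) × EuclideanSpace ℝ (Fin n) →
    EuclideanSpace ℝ (Fin n) × EuclideanSpace ℝ (Fin n) := fun z => (z.2, accel g φ z) with hV
  have hVs : ContDiffAt ℝ 1 V w :=
    contDiffAt_snd.prodMk ((contDiffAt_accel g hφ hwt w.2).of_le (by simp))
  obtain ⟨K, T, hT, hK⟩ := hVs.exists_lipschitzOnWith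
  have htarget : {z : EuclideanSpace ℝ (Fin n) × EuclideanSpace ℝ (Fin n) | z.1 ∈ φ.target} ∈
      𝓝 w := continuousAt_fst.preimage_mem_nhds (φ.open_target.mem_nhds hwt)
  obtain ⟨r, hr, hball⟩ :=
    Metric.nhds_basis_closedBall.mem_iff.1 (inter_mem (inter_mem hS hT) htarget)
  have hcont₀ := (h₀.hasDerivAt_chartState hJ₀ hφ hτ hsτ).continuousAt
  obtain ⟨δ, hδ, hδball⟩ := Metric.eventually_nhds_iff.1
    ((eventually_mem_source hJ₀ h₀.smooth hτ hsτ).and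
      (hcont₀.eventually (Metric.ball_mem_nhds w (half_pos hr))))
  -- The reference state stays within `r / 2` of `w`, and the other state within `r / 2` of the
  -- reference, so both remain in the ball where the vector field is Lipschitz.
  refine ⟨δ, hδ, r / 2, half_pos hr, K, K.2, fun a b ha hb γ J hJ hγ hab η hη hsa hηa => ?_⟩
  have hη0 : 0 ≤ η := (norm_nonneg _).trans hηa
  have hlocal : ∀ t ∈ Icc a b, t ∈ J₀ ∧ γ₀ t ∈ φ.source ∧
      chartState φ γ₀ t ∈ Metric.ball w (r / 2) :=
    fun t ht => by
      have := hδball (y := t) (by rw [Real.dist_eq, abs_lt]; constructor <;> linarith [ht.1, ht.2])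
      exact ⟨this.1.1, this.1.2, this.2⟩
  have hexp : ∀ t ∈ Icc a b, η * Real.exp (K * (t - a)) ≤ η * Real.exp (K * (2 * δ)) := by
    intro t ht
    have : t - a ≤ 2 * δ := by linarith [ht.2]
    have hK0 : (0 : ℝ) ≤ K := K.2
    gcongr
  -- Nothing guarantees in advance that `γ` stays in the chart. A continuous induction on `[a, b]`
  -- proves this together with the exponential bound.
  set s : Set ℝ := {t | γ t ∈ φ.source ∧
    ‖chartState φ γ t - chartState φ γ₀ t‖ ≤ η * Real.exp (K * (t - a))} with hs
  have hsball : ∀ t ∈ s ∩ Icc a b, chartState φ γ t ∈ Metric.ball w r := by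
    intro t ht
    have h1 : dist (chartState φ γ t) (chartState φ γ₀ t) < r / 2 := by
      rw [dist_eq_norm]
      exact (ht.1.2.trans (hexp t ht.2)).trans_lt hη
    have h2 := (hlocal t ht.2).2.2
    rw [Metric.mem_ball] at h2 ⊢
    linarith [dist_triangle (chartState φ γ t) (chartState φ γ₀ t) w]
  have hclosed : IsClosed (s ∩ Icc a b) := by
    refine isClosed_of_closure_subset fun t ht => ?_
    have htI : t ∈ Icc a b := closure_minimal inter_subset_right isClosed_Icc ht
    have hγc : ContinuousAt γ t := (hγ.smooth.contMDiffAt (hJ.mem_nhds (hab htI))).continuousAt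
    have hball1 : Metric.closedBall w.1 r ⊆ φ.target := fun x hx => by
      refine (@hball (x, w.2) ?_).2
      rw [Metric.mem_closedBall, Prod.dist_eq]
      simpa [hr.le] using hx
    -- A limit of times in `s` could leave the chart. The Hausdorff property excludes this: the
    -- image of the compact coordinate ball is closed in `M`, so it contains the limit point.
    have hcpt : IsCompact (φ.symm '' Metric.closedBall w.1 r) :=
      (isCompact_closedBall _ _).image_of_continuousOn (φ.symm.continuousOn.mono hball1)
    have h1 : γ t ∈ φ.symm '' Metric.closedBall w.1 r := by
      rw [← hcpt.isClosed.closure_eq]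
      refine hγc.continuousWithinAt.mem_closure ht fun u hu => ⟨φ (γ u), ?_, φ.left_inv hu.1.1⟩
      have h2 := (hsball u hu)
      rw [Metric.mem_ball, Prod.dist_eq] at h2
      exact (le_max_left _ _).trans h2.le
    have h2 : γ t ∈ φ.source := by
      obtain ⟨x, hx, hxt⟩ := h1
      exact hxt ▸ φ.map_target (hball1 hx)
    refine ⟨⟨h2, ?_⟩, htI⟩
    have hc1 := (hγ.hasDerivAt_chartState hJ hφ (hab htI) h2).continuousAt
    have hc2 := (h₀.hasDerivAt_chartState hJ₀ hφ (hlocal t htI).1 (hlocal t htI).2.1).continuousAt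
    have hc3 : ContinuousAt (fun t => ‖chartState φ γ t - chartState φ γ₀ t‖ -
        η * Real.exp (K * (t - a))) t :=
      (hc1.sub hc2).norm.sub (by fun_prop)
    have h3 := hc3.continuousWithinAt.mem_closure ht (t := Iic 0)
      fun u hu => sub_nonpos.2 hu.1.2
    rw [isClosed_Iic.closure_eq] at h3
    exact sub_nonpos.1 h3
  have hsub : Icc a b ⊆ s := by
    refine hclosed.Icc_subset_of_forall_mem_nhdsWithin ⟨hsa, by simpa using hηa⟩ fun x hx => ?_
    have hxI : x ∈ Icc a b := Ico_subset_Icc_self hx.2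
    have hc1 := (hγ.hasDerivAt_chartState hJ hφ (hab hxI) hx.1.1).continuousAt
    obtain ⟨ε, hε, hεball⟩ := Metric.eventually_nhds_iff.1
      ((eventually_mem_source hJ hγ.smooth (hab hxI) hx.1.1).and
        ((hc1.eventually (Metric.isOpen_ball.mem_nhds (hsball x ⟨hx.1, hxI⟩))).and
          (eventually_lt_nhds hx.2.2)))
    filter_upwards [Ioo_mem_nhdsGT (show x < x + ε by linarith)] with y hy
    have hloc : ∀ t ∈ Icc x y, (t ∈ J ∧ γ t ∈ φ.source) ∧
        chartState φ γ t ∈ Metric.ball w r ∧ t < b :=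
      fun t ht => hεball (by rw [Real.dist_eq, abs_lt]; constructor <;> linarith [ht.1, ht.2, hy.2])
    have hloc₀ : ∀ t ∈ Icc x y, t ∈ Icc a b := fun t ht =>
      ⟨hx.2.1.trans ht.1, (hloc t ht).2.2.le⟩
    have hd1 : ∀ t ∈ Icc x y, HasDerivAt (chartState φ γ) (V (chartState φ γ t)) t := fun t ht =>
      hγ.hasDerivAt_chartState hJ hφ (hloc t ht).1.1 (hloc t ht).1.2
    have hd2 : ∀ t ∈ Icc x y, HasDerivAt (chartState φ γ₀) (V (chartState φ γ₀ t)) t :=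
      fun t ht => h₀.hasDerivAt_chartState hJ₀ hφ (hlocal t (hloc₀ t ht)).1
        (hlocal t (hloc₀ t ht)).2.1
    -- Grönwall is restarted at `x` with the error accumulated since `a`; the exponents add up to
    -- the bound at `y`.
    have key := dist_le_of_trajectories_ODE_of_mem (v := fun _ => V) (s := fun _ => T) (K := K)
      (f := chartState φ γ) (g := chartState φ γ₀) (a := x) (b := y)
      (δ := η * Real.exp (K * (x - a))) (fun _ _ => hK)
      (fun t ht => (hd1 t ht).continuousAt.continuousWithinAt)
      (fun t ht => (hd1 t (Ico_subset_Icc_self ht)).hasDerivWithinAt)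
      (fun t ht => (hball
        (Metric.ball_subset_closedBall (hloc t (Ico_subset_Icc_self ht)).2.1)).1.2)
      (fun t ht => (hd2 t ht).continuousAt.continuousWithinAt)
      (fun t ht => (hd2 t (Ico_subset_Icc_self ht)).hasDerivWithinAt)
      (fun t ht => (hball (Metric.closedBall_subset_closedBall (half_le_self hr.le)
        (Metric.ball_subset_closedBall
          (hlocal t (hloc₀ t (Ico_subset_Icc_self ht))).2.2))).1.2)
      (by rw [dist_eq_norm]; exact hx.1.2) y ⟨hy.1.le, le_rfl⟩
    refine ⟨(hloc y ⟨hy.1.le, le_rfl⟩).1.2, ?_⟩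
    rw [dist_eq_norm, mul_assoc, ← Real.exp_add] at key
    convert key using 3
    ring
  intro t ht
  have h1 := hlocal t ht
  exact ⟨h1.1, h1.2.1, (hsub ht).1,
    (hball (Metric.closedBall_subset_closedBall (half_le_self hr.le)
      (Metric.ball_subset_closedBall h1.2.2))).1.1,
    (hball (Metric.ball_subset_closedBall (hsball t ⟨hsub ht, ht⟩))).1.1,
    (hsub ht).2.trans (hexp t ht)⟩

/-- At time `t`, the curves `γ s` are within `O(s)` of `γ₀` in position and velocity, and the
displacement from `γ₀`, paired with the velocity of `γ₀`, is `t * (s * c) + O(s ^ 2)`. -/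
def IsFirstVariationAt (g : SmoothMetric n M) (φ : Coord n M) (γ₀ : ℝ → M) (γ : ℝ → ℝ → M)
    (c t : ℝ) : Prop :=
  ∃ C : ℝ, ∀ᶠ s in 𝓝 (0 : ℝ), γ s t ∈ φ.source ∧
    ‖chartState φ (γ s) t - chartState φ γ₀ t‖ ≤ C * |s| ∧
    |metricForm g φ (φ (γ₀ t)) (φ (γ s t) - φ (γ₀ t)) (deriv (φ ∘ γ₀) t) - t * (s * c)| ≤ C * s ^ 2

/-- Grönwall carries the `O(s)` closeness from `a` to `b`. By Taylor's formula and the hypothesis on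
the energies, the pairing then has derivative `s * c + O(s ^ 2)`, which is integrated by the mean
value inequality. The length `δ` depends on `γ₀` but not on `s`. -/
theorem SolvesGeodesicODE.exists_isFirstVariationAt_of_le [T2Space M]
    (h₀ : SolvesGeodesicODE g γ₀ J₀)
    (hJ₀ : IsOpen J₀) (hφ : φ ∈ IsManifold.maximalAtlas (𝓡 n) ∞ M) {τ : ℝ} (hτ : τ ∈ J₀)
    (hsτ : γ₀ τ ∈ φ.source) {γ : ℝ → ℝ → M} {c C' : ℝ}
    (hγ : ∀ᶠ s in 𝓝 (0 : ℝ), ∃ J, IsOpen J ∧ Icc 0 1 ⊆ J ∧ SolvesGeodesicODE g (γ s) J ∧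
      ∀ t ∈ Icc (0 : ℝ) 1, |(1 / 2) * g.inner (γ s t) (velocity (γ s) t) (velocity (γ s) t) -
        (1 / 2) * g.inner (γ₀ t) (velocity γ₀ t) (velocity γ₀ t) - s * c| ≤ C' * s ^ 2) :
    ∃ δ > 0, ∀ a ∈ Icc (0 : ℝ) 1, ∀ b ∈ Icc (0 : ℝ) 1, τ - δ < a → b < τ + δ → a ≤ b →
      IsFirstVariationAt g φ γ₀ γ c a → IsFirstVariationAt g φ γ₀ γ c b := by
  obtain ⟨CL, hCL, S, hS, hT⟩ := ((contDiffAt_energy g hφ (φ.map_source hsτ)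
    (deriv (φ ∘ γ₀) τ)).of_le (m := 2) (by norm_cast)).exists_norm_sub_fderiv_le
  obtain ⟨δ, hδ, R, hR, K, hK, hG⟩ := h₀.exists_gronwall hJ₀ hφ hτ hsτ hS
  refine ⟨δ, hδ, fun a ha b hb haτ hbτ hab ⟨C, hC⟩ => ?_⟩
  set D := C * Real.exp (K * (2 * δ)) with hD
  refine ⟨max D (C + (CL * D ^ 2 + C')), ?_⟩
  have hsmall : ∀ᶠ s in 𝓝 (0 : ℝ), C * |s| * Real.exp (K * (2 * δ)) < R := by
    have : Continuous fun s : ℝ => C * |s| * Real.exp (K * (2 * δ)) := by fun_prop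
    refine this.continuousAt.eventually_lt continuousAt_const ?_
    simpa using hR
  filter_upwards [hC, hγ, hsmall] with s ⟨hs1, hs2, hs3⟩ ⟨J, hJ, hJI, hγs, hE⟩ hsR
  have hsub : Icc a b ⊆ Icc 0 1 := Icc_subset_Icc ha.1 hb.2
  have hGs := hG a b haτ hbτ (γ s) J hJ hγs (hsub.trans hJI) _ hsR hs1 hs2
  have hDs : C * |s| * Real.exp (K * (2 * δ)) = D * |s| := by rw [hD]; ring
  rw [hDs] at hGs
  have hbI : b ∈ Icc a b := ⟨hab, le_rfl⟩
  refine ⟨(hGs b hbI).2.2.1, (hGs b hbI).2.2.2.2.2.trans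
    (mul_le_mul_of_nonneg_right (le_max_left _ _) (abs_nonneg s)), ?_⟩
  set B : ℝ → ℝ := fun t =>
    metricForm g φ (φ (γ₀ t)) (φ (γ s t) - φ (γ₀ t)) (deriv (φ ∘ γ₀) t) - t * (s * c) with hB
  have hder : ∀ t ∈ Icc a b, HasDerivWithinAt B (fderiv ℝ (energy g φ) (chartState φ γ₀ t)
      (chartState φ (γ s) t - chartState φ γ₀ t) - s * c) (Icc a b) t := by
    intro t ht
    obtain ⟨h1, h2, h3, -⟩ := hGs t ht
    have h4 := (h₀.hasDerivAt_pairing hJ₀ hφ h1 h2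
      (hγs.hasDerivAt_chart hJ hφ (hJI (hsub ht)) h3)).sub ((hasDerivAt_id t).mul_const (s * c))
    rw [one_mul] at h4
    exact h4.hasDerivWithinAt
  have hbound : ∀ t ∈ Icc a b, ‖fderiv ℝ (energy g φ) (chartState φ γ₀ t)
      (chartState φ (γ s) t - chartState φ γ₀ t) - s * c‖ ≤ (CL * D ^ 2 + C') * s ^ 2 := by
    intro t ht
    obtain ⟨h1, h2, h3, h4, h5, h6⟩ := hGs t ht
    have h7 := hT _ h4 _ h5
    have h8 := hE t (hsub ht)
    rw [← energy_chartState hJ hγs.smooth hφ (hJI (hsub ht)) h3,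
      ← energy_chartState hJ₀ h₀.smooth hφ h1 h2] at h8
    have h9 : CL * ‖chartState φ (γ s) t - chartState φ γ₀ t‖ ^ 2 ≤ CL * D ^ 2 * s ^ 2 := by
      rw [mul_assoc, ← mul_pow, ← sq_abs (D * s), abs_mul]
      have : D * |s| ≤ |D| * |s| := mul_le_mul_of_nonneg_right (le_abs_self D) (abs_nonneg s)
      gcongr
      exact h6.trans this
    rw [Real.norm_eq_abs] at h7 ⊢
    rw [abs_le] at h7 h8 ⊢
    constructor <;> linarith [h7.1, h7.2, h8.1, h8.2]
  have hmv := (convex_Icc a b).norm_image_sub_le_of_norm_hasDerivWithin_le hder hbound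
    ⟨le_rfl, hab⟩ hbI
  have hE0 : 0 ≤ (CL * D ^ 2 + C') * s ^ 2 := (norm_nonneg _).trans (hbound b hbI)
  rw [Real.norm_eq_abs, Real.norm_eq_abs, abs_of_nonneg (sub_nonneg.2 hab)] at hmv
  -- The factor `b - a` is at most `1`, as both times lie in `[0, 1]`.
  have h10 : (CL * D ^ 2 + C') * s ^ 2 * (b - a) ≤ (CL * D ^ 2 + C') * s ^ 2 :=
    mul_le_of_le_one_right hE0 (by linarith [ha.1, hb.2])
  calc |B b| ≤ |B a| + |B b - B a| := by
        simpa using abs_add_le (B a) (B b - B a)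
    _ ≤ C * s ^ 2 + (CL * D ^ 2 + C') * s ^ 2 := add_le_add hs3 (hmv.trans h10)
    _ = (C + (CL * D ^ 2 + C')) * s ^ 2 := by ring
    _ ≤ _ := mul_le_mul_of_nonneg_right (le_max_right _ _) (sq_nonneg s)

end
-- Change of chart and propagation along the whole interval.
section

variable {g : SmoothMetric n M} {γ₀ : ℝ → M} {J₀ : Set ℝ} {φ ψ : Coord n M}

theorem contDiffAt_transition (hφ : φ ∈ IsManifold.maximalAtlas (𝓡 n) ∞ M)
    (hψ : ψ ∈ IsManifold.maximalAtlas (𝓡 n) ∞ M) {q : M} (hqφ : q ∈ φ.source)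
    (hqψ : q ∈ ψ.source) : ContDiffAt ℝ ∞ (ψ ∘ φ.symm) (φ q) := by
  rw [← contMDiffAt_iff_contDiffAt]
  refine ContMDiffAt.comp (φ q) ?_ ((contMDiffOn_symm_of_mem_maximalAtlas hφ).contMDiffAt
    (φ.open_target.mem_nhds (φ.map_source hqφ)))
  rw [φ.left_inv hqφ]
  exact (contMDiffOn_of_mem_maximalAtlas hψ).contMDiffAt (ψ.open_source.mem_nhds hqψ)

theorem fderiv_transition (hφ : φ ∈ IsManifold.maximalAtlas (𝓡 n) ∞ M)
    (hψ : ψ ∈ IsManifold.maximalAtlas (𝓡 n) ∞ M) {x : EuclideanSpace ℝ (Fin n)}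
    (hx : x ∈ φ.target) (hxψ : φ.symm x ∈ ψ.source) (u : EuclideanSpace ℝ (Fin n)) :
    fderiv ℝ (ψ ∘ φ.symm) x u =
      mfderiv (𝓡 n) (𝓡 n) ψ (φ.symm x) (mfderiv (𝓡 n) (𝓡 n) φ.symm x u) := by
  have h1 : MDifferentiableAt (𝓡 n) (𝓡 n) ψ (φ.symm x) :=
    ((contMDiffOn_of_mem_maximalAtlas hψ).contMDiffAt
      (ψ.open_source.mem_nhds hxψ)).mdifferentiableAt (by simp)
  have h2 : MDifferentiableAt (𝓡 n) (𝓡 n) φ.symm x :=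
    ((contMDiffOn_symm_of_mem_maximalAtlas hφ).contMDiffAt
      (φ.open_target.mem_nhds hx)).mdifferentiableAt (by simp)
  have h3 := mfderiv_comp x h1 h2
  rw [mfderiv_eq_fderiv] at h3
  exact congrArg (fun L : EuclideanSpace ℝ (Fin n) →L[ℝ] EuclideanSpace ℝ (Fin n) => L u) h3

theorem metricForm_transition (g : SmoothMetric n M)
    (hφ : φ ∈ IsManifold.maximalAtlas (𝓡 n) ∞ M)
    (hψ : ψ ∈ IsManifold.maximalAtlas (𝓡 n) ∞ M) {x : EuclideanSpace ℝ (Fin n)}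
    (hx : x ∈ φ.target) (hxψ : φ.symm x ∈ ψ.source) (u v : EuclideanSpace ℝ (Fin n)) :
    metricForm g φ x u v = metricForm g ψ (ψ (φ.symm x)) (fderiv ℝ (ψ ∘ φ.symm) x u)
      (fderiv ℝ (ψ ∘ φ.symm) x v) := by
  rw [fderiv_transition hφ hψ hx hxψ, fderiv_transition hφ hψ hx hxψ, metricForm_apply]
  exact inner_eq_metricForm g hψ hxψ _ _

theorem chartState_transition (hφ : φ ∈ IsManifold.maximalAtlas (𝓡 n) ∞ M)
    (hψ : ψ ∈ IsManifold.maximalAtlas (𝓡 n) ∞ M) {γ : ℝ → M} {J : Set ℝ} (hJ : IsOpen J)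
    (hγ : ContMDiffOn 𝓘(ℝ, ℝ) (𝓡 n) ∞ γ J) {t : ℝ} (ht : t ∈ J) (hsφ : γ t ∈ φ.source)
    (hsψ : γ t ∈ ψ.source) :
    chartState ψ γ t = ((ψ ∘ φ.symm) (chartState φ γ t).1,
      fderiv ℝ (ψ ∘ φ.symm) (chartState φ γ t).1 (chartState φ γ t).2) := by
  have h1 : ψ ∘ γ =ᶠ[𝓝 t] (ψ ∘ φ.symm) ∘ (φ ∘ γ) :=
    (eventually_mem_source hJ hγ ht hsφ).mono fun s hs => by simp [φ.left_inv hs.2]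
  have h2 := ((contDiffAt_transition hφ hψ hsφ hsψ).differentiableAt
    (by simp)).hasFDerivAt.comp_hasDerivAt t
    ((contDiffAt_chart_comp hJ hγ hφ ht hsφ).differentiableAt (by simp)).hasDerivAt
  refine Prod.ext h1.self_of_nhds ?_
  exact h1.deriv_eq.trans h2.deriv

/-- States transform by the tangent map of the transition, which is locally Lipschitz. The
displacement transforms by the derivative of the transition up to a quadratic error, and the metric
is invariant under that derivative. -/
theorem IsFirstVariationAt.change_chart (hJ₀ : IsOpen J₀)
    (h₀ : ContMDiffOn 𝓘(ℝ, ℝ) (𝓡 n) ∞ γ₀ J₀)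
    (hφ : φ ∈ IsManifold.maximalAtlas (𝓡 n) ∞ M) (hψ : ψ ∈ IsManifold.maximalAtlas (𝓡 n) ∞ M)
    {t : ℝ} (ht : t ∈ J₀) (hsφ : γ₀ t ∈ φ.source) (hsψ : γ₀ t ∈ ψ.source) {γ : ℝ → ℝ → M}
    (hγ : ∀ᶠ s in 𝓝 (0 : ℝ), ∃ J, IsOpen J ∧ t ∈ J ∧ ContMDiffOn 𝓘(ℝ, ℝ) (𝓡 n) ∞ (γ s) J)
    {c : ℝ} (h : IsFirstVariationAt g φ γ₀ γ c t) : IsFirstVariationAt g ψ γ₀ γ c t := by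
  obtain ⟨C, hC⟩ := h
  set F := ψ ∘ φ.symm with hF
  have hFs := contDiffAt_transition hφ hψ hsφ hsψ
  set z₀ := chartState φ γ₀ t with hz₀
  have hTF : ContDiffAt ℝ 1 (fun z : EuclideanSpace ℝ (Fin n) × EuclideanSpace ℝ (Fin n) =>
      (F z.1, fderiv ℝ F z.1 z.2)) z₀ := by
    have h1 : ContDiffAt ℝ ∞ (fun z : EuclideanSpace ℝ (Fin n) × EuclideanSpace ℝ (Fin n) =>
        F z.1) z₀ := ContDiffAt.comp z₀ (f := Prod.fst) hFs contDiffAt_fst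
    have h2 : ContDiffAt ℝ ∞ (fun z : EuclideanSpace ℝ (Fin n) × EuclideanSpace ℝ (Fin n) =>
        fderiv ℝ F z.1) z₀ :=
      ContDiffAt.comp z₀ (f := Prod.fst) (hFs.fderiv_right (m := ∞) le_rfl) contDiffAt_fst
    exact (h1.prodMk (h2.clm_apply contDiffAt_snd)).of_le (by simp)
  obtain ⟨K, T, hT, hK⟩ := hTF.exists_lipschitzOnWith
  obtain ⟨CT, hCT, S, hS, hTaylor⟩ :=
    (hFs.of_le (m := 2) (by norm_cast)).exists_norm_sub_fderiv_le
  have hsrc : ∀ᶠ z in 𝓝 z₀, φ.symm z.1 ∈ ψ.source := by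
    have h1 : ContinuousAt φ.symm z₀.1 := φ.symm.continuousAt (φ.map_source hsφ)
    have h2 : ContinuousAt (fun z : EuclideanSpace ℝ (Fin n) × EuclideanSpace ℝ (Fin n) =>
      φ.symm z.1) z₀ := ContinuousAt.comp (f := Prod.fst) h1 continuousAt_fst
    refine h2.eventually_mem (ψ.open_source.mem_nhds ?_)
    change φ.symm (φ (γ₀ t)) ∈ _
    rwa [φ.left_inv hsφ]
  -- Closeness in `φ` forces `γ s t` into the source of `ψ` for small `s`, and its coordinates into
  -- the sets where the Lipschitz and Taylor estimates hold.
  have htend : Tendsto (fun s => chartState φ (γ s) t) (𝓝 0) (𝓝 z₀) := by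
    rw [tendsto_iff_norm_sub_tendsto_zero]
    refine squeeze_zero' (Eventually.of_forall fun s => norm_nonneg _)
      (hC.mono fun s hs => hs.2.1) ?_
    have : Continuous fun s : ℝ => C * |s| := by fun_prop
    simpa using this.tendsto 0
  have hS' : ∀ᶠ z in 𝓝 z₀, z.1 ∈ S := continuousAt_fst.eventually_mem hS
  set A := ‖metricForm g ψ (ψ (γ₀ t))‖ * ‖fderiv ℝ F z₀.1 z₀.2‖ * CT with hA
  refine ⟨max (K * C) (A * C ^ 2 + C), ?_⟩
  filter_upwards [hC, hγ, htend.eventually (hsrc.and (hS'.and hT))]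
    with s ⟨hs1, hs2, hs3⟩ ⟨J, hJ, htJ, hγs⟩ ⟨hs4, hs5, hs6⟩
  have hs7 : γ s t ∈ ψ.source := by
    change φ.symm (φ (γ s t)) ∈ _ at hs4
    rwa [φ.left_inv hs1] at hs4
  have hst := chartState_transition hφ hψ hJ hγs htJ hs1 hs7
  have hst₀ := chartState_transition hφ hψ hJ₀ h₀ ht hsφ hsψ
  refine ⟨hs7, ?_, ?_⟩
  · rw [hst, hst₀]
    have h1 := hK.dist_le_mul _ hs6 _ (mem_of_mem_nhds hT)
    rw [dist_eq_norm, dist_eq_norm] at h1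
    refine h1.trans ((mul_le_mul_of_nonneg_left hs2 K.2).trans ?_)
    rw [← mul_assoc]
    exact mul_le_mul_of_nonneg_right (le_max_left _ _) (abs_nonneg s)
  · have e1 : ψ (γ s t) = F (φ (γ s t)) := congrArg Prod.fst hst
    have e2 : ψ (γ₀ t) = F (φ (γ₀ t)) := congrArg Prod.fst hst₀
    have e3 : deriv (ψ ∘ γ₀) t = fderiv ℝ F (φ (γ₀ t)) (deriv (φ ∘ γ₀) t) :=
      congrArg Prod.snd hst₀
    have h1 := metricForm_transition g hφ hψ (φ.map_source hsφ) (by rwa [φ.left_inv hsφ])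
      (φ (γ s t) - φ (γ₀ t)) (deriv (φ ∘ γ₀) t)
    rw [φ.left_inv hsφ, ← hF, ← e3] at h1
    rw [h1] at hs3
    have h2 := hTaylor (φ (γ₀ t)) (mem_of_mem_nhds hS) (φ (γ s t)) hs5
    rw [← hF, ← e1, ← e2] at h2
    have h3 : ‖φ (γ s t) - φ (γ₀ t)‖ ≤ C * |s| := (norm_fst_le _).trans hs2
    have h4 := (metricForm g ψ (ψ (γ₀ t))).le_opNorm₂
      (ψ (γ s t) - ψ (γ₀ t) - fderiv ℝ F (φ (γ₀ t)) (φ (γ s t) - φ (γ₀ t))) (deriv (ψ ∘ γ₀) t)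
    have h5 : ‖φ (γ s t) - φ (γ₀ t)‖ ^ 2 ≤ C ^ 2 * s ^ 2 := by
      rw [← sq_abs s, ← mul_pow]
      gcongr
    rw [map_sub, _root_.sub_apply, Real.norm_eq_abs] at h4
    have h6 : ‖metricForm g ψ (ψ (γ₀ t))‖ * ‖ψ (γ s t) - ψ (γ₀ t) -
        fderiv ℝ F (φ (γ₀ t)) (φ (γ s t) - φ (γ₀ t))‖ * ‖deriv (ψ ∘ γ₀) t‖ ≤ A * C ^ 2 * s ^ 2 := by
      calc _ ≤ ‖metricForm g ψ (ψ (γ₀ t))‖ * (CT * (C ^ 2 * s ^ 2)) * ‖deriv (ψ ∘ γ₀) t‖ := by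
            gcongr
            exact h2.trans (mul_le_mul_of_nonneg_left h5 hCT)
        _ = A * C ^ 2 * s ^ 2 := by
            rw [hA, e3]
            change _ = ‖_‖ * ‖fderiv ℝ F (φ (γ₀ t)) (deriv (φ ∘ γ₀) t)‖ * CT * C ^ 2 * s ^ 2
            ring
    have h7 : A * C ^ 2 * s ^ 2 + C * s ^ 2 ≤ max (K * C) (A * C ^ 2 + C) * s ^ 2 := by
      rw [← add_mul]
      exact mul_le_mul_of_nonneg_right (le_max_right _ _) (sq_nonneg s)
    have h8 := abs_add_le _ _ |>.trans (add_le_add (h4.trans h6) hs3)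
    refine le_trans (le_of_eq ?_) (h8.trans h7)
    congr 1
    ring

theorem SolvesGeodesicODE.isFirstVariationAt_one [T2Space M] (h₀ : SolvesGeodesicODE g γ₀ J₀)
    (hJ₀ : IsOpen J₀) (hI : Icc 0 1 ⊆ J₀) {γ : ℝ → ℝ → M} {c C' : ℝ}
    (hγ : ∀ᶠ s in 𝓝 (0 : ℝ), ∃ J, IsOpen J ∧ Icc 0 1 ⊆ J ∧ SolvesGeodesicODE g (γ s) J ∧
      ∀ t ∈ Icc (0 : ℝ) 1, |(1 / 2) * g.inner (γ s t) (velocity (γ s) t) (velocity (γ s) t) -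
        (1 / 2) * g.inner (γ₀ t) (velocity γ₀ t) (velocity γ₀ t) - s * c| ≤ C' * s ^ 2)
    (hφ : φ ∈ IsManifold.maximalAtlas (𝓡 n) ∞ M) (hs0 : γ₀ 0 ∈ φ.source)
    (h : IsFirstVariationAt g φ γ₀ γ c 0)
    (hψ : ψ ∈ IsManifold.maximalAtlas (𝓡 n) ∞ M) (hs1 : γ₀ 1 ∈ ψ.source) :
    IsFirstVariationAt g ψ γ₀ γ c 1 := by
  -- Quantifying over all charts at `γ₀ t` lets each step of the induction use its own chart.
  set Q : ℝ → Prop := fun t => ∀ φ ∈ IsManifold.maximalAtlas (𝓡 n) ∞ M, γ₀ t ∈ φ.source →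
    IsFirstVariationAt g φ γ₀ γ c t with hQ
  have hchange : ∀ t ∈ Icc (0 : ℝ) 1, ∀ φ ∈ IsManifold.maximalAtlas (𝓡 n) ∞ M,
      γ₀ t ∈ φ.source → IsFirstVariationAt g φ γ₀ γ c t → Q t := fun t ht φ hφ hs h φ' hφ' hs' =>
    h.change_chart hJ₀ h₀.smooth hφ hφ' (hI ht) hs hs'
      (hγ.mono fun s ⟨J, hJ, hIJ, hs, _⟩ => ⟨J, hJ, hIJ ht, hs.smooth⟩)
  have hloc : ∀ τ : Icc (0 : ℝ) 1, ∃ δ > 0, ∀ a ∈ Icc (0 : ℝ) 1, ∀ b ∈ Icc (0 : ℝ) 1,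
      |a - τ| < δ → |b - τ| < δ → a ≤ b → Q a → Q b := by
    intro τ
    have hφ := IsManifold.chart_mem_maximalAtlas (I := 𝓡 n) (n := ∞) (γ₀ τ)
    have hs := mem_chart_source (EuclideanSpace ℝ (Fin n)) (γ₀ τ)
    obtain ⟨δ, hδ, h1⟩ := h₀.exists_isFirstVariationAt_of_le hJ₀ hφ (hI τ.2) hs hγ
    obtain ⟨δ', hδ', h2⟩ := Metric.eventually_nhds_iff.1
      (eventually_mem_source hJ₀ h₀.smooth (hI τ.2) hs)
    refine ⟨min δ δ', lt_min hδ hδ', fun a ha b hb haτ hbτ hab hQa => ?_⟩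
    rw [lt_min_iff, abs_lt] at haτ hbτ
    exact hchange b hb _ hφ (h2 hbτ.2).2 (h1 a ha b hb (by linarith [haτ.1.1])
      (by linarith [hbτ.1.2]) hab (hQa _ hφ (h2 haτ.2).2))
  choose δ hδ hstep using hloc
  -- By compactness, a finite subdivision of `[0, 1]` has each piece inside one neighbourhood where
  -- a single chart propagates the property.
  obtain ⟨t, ht0, htm, ⟨m, hm⟩, htc⟩ := exists_monotone_Icc_subset_open_cover_Icc
    (zero_le_one (α := ℝ)) (c := fun τ : Icc (0 : ℝ) 1 => {t | |(t : ℝ) - τ| < δ τ})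
    (fun τ => isOpen_lt (by fun_prop) continuous_const)
    (fun τ _ => mem_iUnion.2 ⟨τ, by simpa using hδ τ⟩)
  have hind : ∀ k, Q (t k) := by
    intro k
    induction k with
    | zero =>
      rw [ht0]
      exact hchange 0 ⟨le_rfl, zero_le_one⟩ φ hφ hs0 h
    | succ k ih =>
      obtain ⟨τ, hτ⟩ := htc k
      have hle : t k ≤ t (k + 1) := htm k.le_succ
      exact hstep τ _ (t k).2 _ (t (k + 1)).2 (hτ ⟨le_rfl, hle⟩) (hτ ⟨hle, le_rfl⟩) hle ih
  have hQm := hind m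
  rw [hm m le_rfl] at hQm
  exact hQm ψ hψ hs1

end

/-! ### Geodesics with prescribed initial position and velocity. -/

/-- `γ` solves the geodesic equation on an open interval containing `[0, 1]`, with initial
position `p` and initial velocity `v`. -/
structure SolvesGeodesicIVP (g : SmoothMetric n M) (p : M) (v : EuclideanSpace ℝ (Fin n))
    (γ : ℝ → M) : Prop where
  exists_solves : ∃ ε > 0, SolvesGeodesicODE g γ (Ioo (-ε) (1 + ε))
  map_zero : γ 0 = p
  deriv_zero : ∀ φ ∈ IsManifold.maximalAtlas (𝓡 n) ∞ M, p ∈ φ.source →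
    deriv (φ ∘ γ) 0 = mfderiv (𝓡 n) (𝓡 n) φ p v

theorem Icc_subset_Ioo_neg_add {ε : ℝ} (hε : 0 < ε) : Icc (0 : ℝ) 1 ⊆ Ioo (-ε) (1 + ε) :=
  Icc_subset_Ioo (by linarith) (by linarith)

section

variable {g : SmoothMetric n M} {p : M} {v w : EuclideanSpace ℝ (Fin n)} {γ : ℝ → M}

theorem IsGeodesicFrom.solvesGeodesicIVP (h : IsGeodesicFrom g p v γ) :
    SolvesGeodesicIVP g p v γ := by
  obtain ⟨⟨ε, hε, hγ⟩, h0⟩ := h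
  have hp : γ 0 = p := congrArg (fun z : TangentBundle (𝓡 n) M => z.1) h0
  refine ⟨⟨ε, hε, hγ.solvesGeodesicODE isOpen_Ioo⟩, hp, fun φ hφ hpφ => ?_⟩
  rw [← mfderiv_chart_velocity isOpen_Ioo hγ.smooth hφ
    (Icc_subset_Ioo_neg_add hε ⟨le_rfl, zero_le_one⟩) (hp ▸ hpφ)]
  exact congrArg (fun z : TangentBundle (𝓡 n) M =>
    (mfderiv (𝓡 n) (𝓡 n) φ z.1 z.2 : EuclideanSpace ℝ (Fin n))) h0

theorem SolvesGeodesicIVP.inner_velocity (h : SolvesGeodesicIVP g p v γ) :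
    ∃ J, IsOpen J ∧ Icc 0 1 ⊆ J ∧ SolvesGeodesicODE g γ J ∧
      ∀ t ∈ Icc (0 : ℝ) 1, g.inner (γ t) (velocity γ t) (velocity γ t) = g.inner p v v := by
  obtain ⟨⟨ε, hε, hγ⟩, hp, h0⟩ := h
  have hI := Icc_subset_Ioo_neg_add hε
  have h0I : (0 : ℝ) ∈ Ioo (-ε) (1 + ε) := hI ⟨le_rfl, zero_le_one⟩
  refine ⟨_, isOpen_Ioo, hI, hγ, fun t ht => ?_⟩
  rw [hγ.inner_velocity_eq isOpen_Ioo isPreconnected_Ioo (hI ht) h0I]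
  have hφ := IsManifold.chart_mem_maximalAtlas (I := 𝓡 n) (n := ∞) p
  have hs := mem_chart_source (EuclideanSpace ℝ (Fin n)) p
  have h1 := energy_chartState isOpen_Ioo hγ.smooth hφ h0I (g := g) (hp ▸ hs)
  have h2 := inner_eq_metricForm g hφ hs v v
  rw [energy, chartState, h0 _ hφ hs] at h1
  dsimp only at h1
  rw [congrArg (chartAt (EuclideanSpace ℝ (Fin n)) p) hp] at h1
  linarith

/-- Constancy of speed reduces the energy hypothesis to expanding `g(v + s • w, v + s • w)` at `p`.
At time `0` the displacement vanishes and the coordinate velocities differ linearly in `s`. -/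
theorem isFirstVariationAt_one [T2Space M] {γ₀ : ℝ → M} (h₀ : SolvesGeodesicIVP g p v γ₀)
    {γ : ℝ → ℝ → M} (hγ : ∀ᶠ s in 𝓝 (0 : ℝ), SolvesGeodesicIVP g p (v + s • w) (γ s))
    {ψ : Coord n M} (hψ : ψ ∈ IsManifold.maximalAtlas (𝓡 n) ∞ M) (hs1 : γ₀ 1 ∈ ψ.source) :
    IsFirstVariationAt g ψ γ₀ γ (g.inner p v w) 1 := by
  obtain ⟨J₀, hJ₀, hI₀, hS₀, hE₀⟩ := h₀.inner_velocity
  have hφ := IsManifold.chart_mem_maximalAtlas (I := 𝓡 n) (n := ∞) p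
  have hs := mem_chart_source (EuclideanSpace ℝ (Fin n)) p
  -- The remainder in the energies is exactly `s ^ 2` times half of `g(w, w)`, whence the constant
  -- `C'`.
  refine hS₀.isFirstVariationAt_one hJ₀ hI₀ (C' := |(1 / 2) * g.inner p w w|) ?_ hφ
    (h₀.map_zero ▸ hs) ?_ hψ hs1
  · filter_upwards [hγ] with s hγs
    obtain ⟨J, hJ, hI, hS, hE⟩ := hγs.inner_velocity
    refine ⟨J, hJ, hI, hS, fun t ht => ?_⟩
    rw [hE t ht, hE₀ t ht]
    have h1 : g.inner p (v + s • w) (v + s • w) =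
        g.inner p v v + 2 * s * g.inner p v w + s ^ 2 * g.inner p w w := by
      -- Stated for an arbitrary form on `ℝⁿ`, to keep tangent space types out of the algebra.
      have hgen : ∀ B : EuclideanSpace ℝ (Fin n) →L[ℝ] EuclideanSpace ℝ (Fin n) →L[ℝ] ℝ,
          (B v w = B w v) → B (v + s • w) (v + s • w) = B v v + 2 * s * B v w + s ^ 2 * B w w := by
        intro B hB
        simp only [map_add, map_smul, _root_.add_apply, _root_.smul_apply, smul_eq_mul, ← hB]
        ring
      exact hgen (g.inner p) (g.symm p v w)
    rw [h1, ← abs_of_nonneg (sq_nonneg s), ← abs_mul]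
    rw [abs_of_nonneg (sq_nonneg s)]
    apply le_of_eq
    congr 1
    ring
  · have hgen : ∀ L : EuclideanSpace ℝ (Fin n) →L[ℝ] EuclideanSpace ℝ (Fin n), ∃ C : ℝ, 0 ≤ C ∧
        ∀ (s : ℝ) (x : EuclideanSpace ℝ (Fin n)),
          ‖(x, L (v + s • w)) - (x, L v)‖ ≤ C * |s| := fun L =>
      ⟨‖L w‖, norm_nonneg _, fun s x => by simp [norm_smul, mul_comm, mul_nonneg]⟩
    obtain ⟨C, hC, hCs⟩ := hgen (mfderiv (𝓡 n) (𝓡 n) (chartAt (EuclideanSpace ℝ (Fin n)) p) p)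
    refine ⟨C, ?_⟩
    filter_upwards [hγ] with s hγs
    refine ⟨hγs.map_zero ▸ hs, ?_, ?_⟩
    · rw [chartState, chartState, hγs.deriv_zero _ hφ hs, h₀.deriv_zero _ hφ hs, hγs.map_zero,
        h₀.map_zero]
      exact hCs s _
    · rw [hγs.map_zero, h₀.map_zero, sub_self]
      simpa using mul_nonneg hC (sq_nonneg s)

/-- Uniqueness of the endpoint of a geodesic with given initial data. -/
theorem SolvesGeodesicIVP.apply_one_eq [T2Space M] {γ₀ : ℝ → M}
    (h₀ : SolvesGeodesicIVP g p v γ₀) (h : SolvesGeodesicIVP g p v γ) : γ 1 = γ₀ 1 := by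
  have hφ := IsManifold.chart_mem_maximalAtlas (I := 𝓡 n) (n := ∞) (γ₀ 1)
  have hs := mem_chart_source (EuclideanSpace ℝ (Fin n)) (γ₀ 1)
  -- Apply the first variation to the constant family `γ` with `w = 0`; at `s = 0` the bound `C *
  -- |s|` vanishes.
  obtain ⟨C, hC⟩ := isFirstVariationAt_one (w := 0) (γ := fun _ => γ) h₀ (by simpa using h) hφ hs
  obtain ⟨h1, h2, -⟩ := hC.self_of_nhds
  rw [abs_zero, mul_zero, norm_le_zero_iff, sub_eq_zero] at h2
  exact (chartAt (EuclideanSpace ℝ (Fin n)) (γ₀ 1)).injOn h1 hs (congrArg Prod.fst h2)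

theorem SolvesGeodesicIVP.comp_mul (h : SolvesGeodesicIVP g p v γ) :
    ∀ᶠ c in 𝓝 (1 : ℝ), SolvesGeodesicIVP g p (c • v) (fun t => γ (c * t)) := by
  obtain ⟨⟨ε, hε, hγ⟩, hp, h0⟩ := h
  have hc : ∀ᶠ c in 𝓝 (1 : ℝ), c ∈ Ioo (0 : ℝ) (1 + ε / 2) :=
    Ioo_mem_nhds zero_lt_one (by linarith)
  filter_upwards [hc] with c hc
  -- For `0 < c < 1 + ε / 2`, rescaling this margin `m` by `c` gives at most `ε / 4`, so `c * (1 +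
  -- m) < 1 + 3 * ε / 4`, inside the old interval.
  refine ⟨⟨ε / 4 / (1 + ε / 2), by positivity, ?_⟩, by simpa using hp,
    fun φ hφ hpφ => ?_⟩
  · have hsol := hγ.comp_mul c
    have hsub : Ioo (-(ε / 4 / (1 + ε / 2))) (1 + ε / 4 / (1 + ε / 2)) ⊆
        (fun t => c * t) ⁻¹' Ioo (-ε) (1 + ε) := by
      intro t ht
      set m := ε / 4 / (1 + ε / 2) with hm
      have hm0 : 0 < m := by positivity
      have hm1 : (1 + ε / 2) * m = ε / 4 := by rw [hm]; field_simp
      have hcm : c * m ≤ ε / 4 := hm1 ▸ mul_le_mul_of_nonneg_right hc.2.le hm0.le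
      have h1 : c * (-m) < c * t := mul_lt_mul_of_pos_left ht.1 hc.1
      have h2 : c * t < c * (1 + m) := mul_lt_mul_of_pos_left ht.2 hc.1
      exact ⟨by linarith, by linarith [hc.2]⟩
    exact ⟨hsol.smooth.mono hsub, fun φ hφ t ht => hsol.hasDerivAt φ hφ t (hsub ht)⟩
  · have h1 : deriv (φ ∘ fun t => γ (c * t)) 0 = c • deriv (φ ∘ γ) (c * 0) :=
      deriv_comp_mul_left c (φ ∘ γ) 0
    rw [h1, mul_zero, h0 φ hφ hpφ]
    have hgen : ∀ B : EuclideanSpace ℝ (Fin n) →L[ℝ] EuclideanSpace ℝ (Fin n),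
      c • B v = B (c • v) := fun B => by simp
    exact hgen _

end

/-! ### The exponential map and the Gauss lemma. -/

open Classical in
/-- The geodesic whose endpoint is `expMap g p v`. -/
def expCurve (g : SmoothMetric n M) (p : M) (v : EuclideanSpace ℝ (Fin n)) : ℝ → M :=
  if h : v ∈ expDomain g p then h.choose else fun _ => p

theorem expMap_eq_expCurve (g : SmoothMetric n M) (p : M) (v : EuclideanSpace ℝ (Fin n)) :
    expMap g p v = expCurve g p v 1 := by
  unfold expMap expCurve
  split_ifs <;> rfl

theorem solvesGeodesicIVP_expCurve {g : SmoothMetric n M} {p : M} {v : EuclideanSpace ℝ (Fin n)}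
    (h : v ∈ expDomain g p) : SolvesGeodesicIVP g p v (expCurve g p v) := by
  rw [expCurve, dif_pos h]
  exact h.choose_spec.solvesGeodesicIVP

end RiemannianGeometry

end

open RiemannianGeometry

theorem mainTheorem7 {n : ℕ} {M : Type*} [TopologicalSpace M] [T2Space M]
    [SecondCountableTopology M] [ChartedSpace (EuclideanSpace ℝ (Fin n)) M]
    [IsManifold (𝓡 n) ∞ M] (g : RiemannianGeometry.SmoothMetric n M) (p : M)
    (U : Set (EuclideanSpace ℝ (Fin n))) (hU0 : (0 : EuclideanSpace ℝ (Fin n)) ∈ U)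
    (hUdom : U ⊆ RiemannianGeometry.expDomain g p)
    (hUdiffeo : RiemannianGeometry.IsDiffeoOnImage (RiemannianGeometry.expMap g p) U)
    (v : EuclideanSpace ℝ (Fin n)) (hv : v ∈ U) (w : EuclideanSpace ℝ (Fin n)) :
    g.inner (RiemannianGeometry.expMap g p v)
      (RiemannianGeometry.dExp g p v v) (RiemannianGeometry.dExp g p v w) =
    g.inner p v w := by
  set γ₀ := expCurve g p v with hγ₀
  set q := expMap g p v with hq
  have hq1 : γ₀ 1 = q := (expMap_eq_expCurve g p v).symm
  have h₀ : SolvesGeodesicIVP g p v γ₀ := solvesGeodesicIVP_expCurve (hUdom hv)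
  set ψ : Coord n M := chartAt (EuclideanSpace ℝ (Fin n)) q with hψdef
  have hψ : ψ ∈ IsManifold.maximalAtlas (𝓡 n) ∞ M := IsManifold.chart_mem_maximalAtlas q
  have hs : q ∈ ψ.source := mem_chart_source (EuclideanSpace ℝ (Fin n)) q
  have hexp : MDifferentiableAt (𝓡 n) (𝓡 n) (expMap g p) v :=
    (hUdiffeo.smooth.contMDiffAt (hUdiffeo.isOpen_source.mem_nhds hv)).mdifferentiableAt (by simp)
  have hψd : MDifferentiableAt (𝓡 n) (𝓡 n) ψ (expMap g p v) :=
    ((contMDiffOn_of_mem_maximalAtlas hψ).contMDiffAt (ψ.open_source.mem_nhds hs)).mdifferentiableAt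
      (by simp)
  have hP : DifferentiableAt ℝ (ψ ∘ expMap g p) v := (hψd.comp v hexp).differentiableAt
  set D := fderiv ℝ (ψ ∘ expMap g p) v with hD
  have hDu : ∀ u, D u = mfderiv (𝓡 n) (𝓡 n) ψ q (dExp g p v u) := by
    intro u
    have h3 := mfderiv_comp v hψd hexp
    rw [mfderiv_eq_fderiv] at h3
    exact congrArg (fun L : EuclideanSpace ℝ (Fin n) →L[ℝ] EuclideanSpace ℝ (Fin n) => L u) h3
  set y := deriv (ψ ∘ γ₀) 1 with hy
  -- The radial derivative: near `c = 1` one has `exp(cv) = γ₀(c)`, by rescaling time and by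
  -- uniqueness of the endpoint, which makes the chosen geodesic immaterial.
  have hDv : D v = y := by
    obtain ⟨ε, hε, hγ⟩ := h₀.exists_solves
    have h1 : HasDerivAt (ψ ∘ γ₀) y 1 :=
      ((contDiffAt_chart_comp isOpen_Ioo hγ.smooth hψ
        (Icc_subset_Ioo_neg_add hε ⟨zero_le_one, le_rfl⟩) (hq1 ▸ hs)).differentiableAt
          (by simp)).hasDerivAt
    have h2 : HasDerivAt (fun c : ℝ => c • v) v 1 := by
      simpa using (hasDerivAt_id (1 : ℝ)).smul_const v
    have h3 : HasDerivAt (fun c : ℝ => (ψ ∘ expMap g p) (c • v)) (D v) 1 := by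
      have h4 : HasFDerivAt (ψ ∘ expMap g p) D ((1 : ℝ) • v) := by
        rw [one_smul]
        exact hP.hasFDerivAt
      exact h4.comp_hasDerivAt 1 h2
    refine h3.unique (h1.congr_of_eventuallyEq ?_)
    have hU : ∀ᶠ c in 𝓝 (1 : ℝ), c • v ∈ U :=
      h2.continuousAt.eventually_mem (hUdiffeo.isOpen_source.mem_nhds (by simpa using hv))
    filter_upwards [hU, h₀.comp_mul] with c hc1 hc2
    have h5 := hc2.apply_one_eq (solvesGeodesicIVP_expCurve (hUdom hc1))
    rw [mul_one] at h5
    rw [Function.comp_apply, expMap_eq_expCurve, h5, Function.comp_apply]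
  -- The pairing at time `1`, as a function of `s`, is differentiated at `0` twice: by the chain
  -- rule, and from the first variation estimate, whose `O(s ^ 2)` error is `o(s)`.
  have hDw : metricForm g ψ (ψ q) (D w) y = g.inner p v w := by
    have h2 : HasDerivAt (fun s : ℝ => v + s • w) w 0 := by
      simpa using ((hasDerivAt_id (0 : ℝ)).smul_const w).const_add v
    have hU : ∀ᶠ s in 𝓝 (0 : ℝ), v + s • w ∈ U :=
      h2.continuousAt.eventually_mem (hUdiffeo.isOpen_source.mem_nhds (by simpa using hv))
    obtain ⟨C, hC⟩ := isFirstVariationAt_one (γ := fun s => expCurve g p (v + s • w)) (w := w) h₀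
      (hU.mono fun s hs => solvesGeodesicIVP_expCurve (hUdom hs)) hψ (hq1 ▸ hs)
    set f : ℝ → ℝ := fun s =>
      metricForm g ψ (ψ q) ((ψ ∘ expMap g p) (v + s • w) - ψ q) y with hf
    have h3 : HasDerivAt f (metricForm g ψ (ψ q) (D w) y) 0 := by
      have h4 : HasFDerivAt (ψ ∘ expMap g p) D (v + (0 : ℝ) • w) := by
        rw [zero_smul, add_zero]
        exact hP.hasFDerivAt
      have h5 := (h4.comp_hasDerivAt 0 h2).sub_const (ψ q)
      exact ((metricForm g ψ (ψ q)).flip y).hasFDerivAt.comp_hasDerivAt 0 h5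
    have h6 : HasDerivAt f (g.inner p v w) 0 := by
      rw [hasDerivAt_iff_isLittleO]
      have h7 : (fun s : ℝ => f s - f 0 - (s - 0) • g.inner p v w) =O[𝓝 0] fun s : ℝ => s ^ 2 := by
        refine Asymptotics.IsBigO.of_bound C (hC.mono fun s hs => ?_)
        have h8 : f 0 = 0 := by simp [hf, hq]
        rw [h8, Real.norm_eq_abs, Real.norm_eq_abs, abs_of_nonneg (sq_nonneg s), sub_zero, sub_zero,
          smul_eq_mul]
        have h9 := hs.2.2
        dsimp only at h9
        rw [← expMap_eq_expCurve, hq1, one_mul] at h9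
        exact h9
      refine h7.trans_isLittleO ?_
      simpa using Asymptotics.isLittleO_pow_id (𝕜 := ℝ) (one_lt_two)
    exact h3.unique h6
  rw [inner_eq_metricForm g hψ hs]
  rw [metricForm_symm] at hDw
  rw [← hDw, ← hDv, hDu v, hDu w]
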